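/- All modules are over $\mathbb{C}$. For a partition $\mu\vdash b$ let $S^\mu$ be the Specht module of the symmetric group $S_b$ (the span of the polytabloids $e_t$, $t$ a $\mu$-tableau), and let $\mu^\perp$ be the conjugate partition. For $\nu\vdash b$ and $a\ge 0$ let $F_\nu^a=\big(\mathrm{Inf}_{S_b}^{S_a\wr S_b}S^\nu\big)\uparrow^{S_{ab}}$ be the generalized Foulkes module: $S^\nu$ is inflated along the projection $S_a\wr S_b\to S_b$ and then induced along $S_a\wr S_b\to S_{ab}$, where $S_a\wr S_b$ acts on the parts of a fixed ordered partition $X^0$ of $\{1,\dots,ab\}$ into $b$ sets of size $a$ (with $S_0\wr S_b=S_b$ for $a=0$). For an ordered set partition $X=gX^0$ ($g\in S_{ab}$) and a $\nu$-tableau $t$ put $e_{t_X}=g\,e_t\in F_\nu^a$, where $e_t\in S^\nu$ is regarded as an element of the induced module. For $a\ge 1$ let $U_{\nu,a}$, the $(1^b)$-summand of the restriction of $F_\nu^a$ to $S_b\times S_{ab-b}$ ($S_b$ acting on $\{1,\dots,b\}$ and $S_{ab-b}$ on $\{b+1,\dots,ab\}$), be the submodule generated by all $e_{t_X}$ such that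 every part of $X$ contains exactly one element of $\{1,\dots,b\}$. **Corollary.** For all integers $a\ge 1$ and $b\ge 0$ there is an isomorphism of $S_b\times S_{ab-b}$-modules $$U_{(1^b),a}\;\cong\;\bigoplus_{\lambda\vdash b} S^{\lambda^\perp}\otimes F_\lambda^{a-1},$$ and in particular, for $a=2$, an isomorphism of $S_b\times S_b$-modules $$U_{(1^b),2}\;\cong\;\bigoplus_{\lambda\vdash b} S^{\lambda^\perp}\otimes S^{\lambda},$$ where $\otimes$ is the external tensor product. -/

import Mathlib

open scoped TensorProduct DirectSum

noncomputable section

namespace GenFoulkes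

/-! ### Partitions as Young diagrams -/

/-- The partitions of `n`, as Young diagrams with `n` boxes. The box `(i, j)` lies in row `i` and
column `j` (counted from `0`), so the parts of the partition are the row lengths. -/
abbrev Ptn (n : ℕ) : Type := {μ : YoungDiagram // μ.card = n}

theorem card_transpose (μ : YoungDiagram) : μ.transpose.card = μ.card := by
  unfold YoungDiagram.card YoungDiagram.transpose
  simp

/-- The conjugate partition. -/
def Ptn.conj {n : ℕ} (μ : Ptn n) : Ptn n :=
  ⟨μ.1.transpose, (card_transpose μ.1).trans μ.2⟩

/-- The partition `(1^n)`: a single column of `n` boxes. -/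
def column (n : ℕ) : Ptn n :=
  ⟨{ cells := (Finset.range n).map ⟨fun i => (i, 0), fun i j h => (Prod.mk.inj h).1⟩
     isLowerSet := by
      rintro ⟨i, j⟩ ⟨i', j'⟩ ⟨h₁, h₂⟩ h
      simp only [Finset.coe_map, Set.mem_image, Finset.mem_coe, Finset.mem_range] at h ⊢
      obtain ⟨x, hx, hxy⟩ := h
      obtain ⟨rfl, rfl⟩ := Prod.mk.inj hxy
      exact ⟨i', lt_of_le_of_lt h₁ hx, Prod.ext rfl (Nat.le_zero.mp h₂).symm⟩ }, by
    simp [YoungDiagram.card]⟩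

/-! ### Specht modules -/

/-- A `μ`-tableau: a bijective filling of the boxes of `μ`, given by the map that sends each entry
to its box. -/
abbrev Tableau {n : ℕ} (μ : Ptn n) : Type := Fin n ≃ {c : ℕ × ℕ // c ∈ μ.1.cells}

/-- The row of the entry `x` in the tableau `t`. -/
def Tableau.row {n : ℕ} {μ : Ptn n} (t : Tableau μ) (x : Fin n) : ℕ := (t x).1.1

/-- The column of the entry `x` in the tableau `t`. -/
def Tableau.col {n : ℕ} {μ : Ptn n} (t : Tableau μ) (x : Fin n) : ℕ := (t x).1.2

/-- The symmetric group permutes the entries of a tableau: the entry `σ x` of `σ t` is in the box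
of the entry `x` of `t`. -/
def Tableau.act {n : ℕ} {μ : Ptn n} (σ : Equiv.Perm (Fin n)) (t : Tableau μ) : Tableau μ :=
  σ.symm.trans t

/-- Two tableaux are row equivalent if they have the same entries in each row. -/
def rowSetoid {n : ℕ} (μ : Ptn n) : Setoid (Tableau μ) where
  r t s := ∀ x, t.row x = s.row x
  iseqv := ⟨fun _ _ => rfl, fun h x => (h x).symm, fun h h' x => (h x).trans (h' x)⟩

/-- The `μ`-tabloids: row equivalence classes of `μ`-tableaux. -/
def Tabloid {n : ℕ} (μ : Ptn n) : Type := Quotient (rowSetoid μ)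

/-- The tabloid `{t}`. -/
def Tabloid.mk {n : ℕ} {μ : Ptn n} (t : Tableau μ) : Tabloid μ := Quotient.mk (rowSetoid μ) t

/-- The action `σ {t} = {σ t}` of the symmetric group on tabloids. -/
instance tabloidAction {n : ℕ} (μ : Ptn n) : MulAction (Equiv.Perm (Fin n)) (Tabloid μ) where
  smul σ := Quotient.map (Tableau.act σ) fun _ _ h x => h (σ.symm x)
  one_smul := by rintro ⟨t⟩; rfl
  mul_smul := by rintro σ τ ⟨t⟩; rfl

theorem smul_mk {n : ℕ} {μ : Ptn n} (σ : Equiv.Perm (Fin n)) (t : Tableau μ) :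
    σ • Tabloid.mk t = Tabloid.mk (t.act σ) := rfl

/-- The permutation module `M^μ` on the `μ`-tabloids, over `ℂ`. -/
abbrev tabloidModule {n : ℕ} (μ : Ptn n) :
    Representation ℂ (Equiv.Perm (Fin n)) (MonoidAlgebra ℂ (Tabloid μ)) :=
  Representation.ofMulAction ℂ (Equiv.Perm (Fin n)) (Tabloid μ)

/-- The column stabilizer `C_t`: the permutations that map each column of `t` to itself. -/
def colStab {n : ℕ} {μ : Ptn n} (t : Tableau μ) : Subgroup (Equiv.Perm (Fin n)) where
  carrier := {π | ∀ x, t.col (π x) = t.col x}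
  one_mem' _ := rfl
  mul_mem' {π ρ} hπ hρ x := (hπ (ρ x)).trans (hρ x)
  inv_mem' {π} hπ x := by
    have h := hπ (π⁻¹ x)
    rwa [← Equiv.Perm.mul_apply, mul_inv_cancel, Equiv.Perm.one_apply, eq_comm] at h

open scoped Classical in
/-- The polytabloid `e_t = ∑_{π ∈ C_t} sgn(π) {π t}`. -/
def polytabloid {n : ℕ} {μ : Ptn n} (t : Tableau μ) : MonoidAlgebra ℂ (Tabloid μ) :=
  ∑ π : colStab t, ((Equiv.Perm.sign π.1 : ℤ) : ℂ) •
    MonoidAlgebra.single (Tabloid.mk (t.act π.1)) (1 : ℂ)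

theorem mem_colStab_act {n : ℕ} {μ : Ptn n} (σ π : Equiv.Perm (Fin n)) (t : Tableau μ) :
    σ * π * σ⁻¹ ∈ colStab (t.act σ) ↔ π ∈ colStab t := by
  constructor
  · intro h x
    have := h (σ x)
    simpa [Tableau.col, Tableau.act] using this
  · intro h x
    have := h (σ⁻¹ x)
    simpa [Tableau.col, Tableau.act, Equiv.Perm.inv_def] using this

/-- `σ e_t = e_{σ t}`. -/
theorem tabloidModule_polytabloid {n : ℕ} {μ : Ptn n} (σ : Equiv.Perm (Fin n)) (t : Tableau μ) :
    tabloidModule μ σ (polytabloid t) = polytabloid (t.act σ) := by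
  classical
  unfold polytabloid
  rw [map_sum]
  refine Fintype.sum_equiv
    ((MulAut.conj σ).toEquiv.subtypeEquiv fun π => (mem_colStab_act σ π t).symm) _ _ ?_
  rintro ⟨π, hπ⟩
  have h : (t.act σ).act (σ * π * σ⁻¹) = (t.act π).act σ := by
    refine Equiv.ext fun x => ?_
    change t (σ.symm (σ (π.symm (σ.symm x)))) = t (π.symm (σ.symm x))
    rw [Equiv.symm_apply_apply]
  have h' : Equiv.Perm.sign (σ * π * σ⁻¹) = Equiv.Perm.sign π := by
    rw [map_mul, map_mul, map_inv, mul_comm, inv_mul_cancel_left]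
  simp only [map_smul, Representation.ofMulAction_single, smul_mk, Equiv.subtypeEquiv,
    Equiv.coe_fn_mk, MulEquiv.toEquiv_eq_coe, MulEquiv.coe_toEquiv, MulAut.conj_apply, h, h']

/-- The Specht module `S^μ` as a submodule of `M^μ`: the span of the polytabloids. -/
def spechtSub {n : ℕ} (μ : Ptn n) : Subrepresentation (tabloidModule μ) where
  toSubmodule := Submodule.span ℂ (Set.range fun t : Tableau μ => polytabloid t)
  apply_mem_toSubmodule σ v hv := by
    refine Submodule.span_induction ?_ (by simp) (fun _ _ _ _ h h' => ?_) (fun c _ _ h => ?_) hv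
    · rintro _ ⟨t, rfl⟩
      rw [tabloidModule_polytabloid]
      exact Submodule.subset_span ⟨_, rfl⟩
    · rw [map_add]; exact Submodule.add_mem _ h h'
    · rw [map_smul]; exact Submodule.smul_mem _ c h

/-- The Specht module `S^μ` as a representation of the symmetric group. -/
abbrev specht {n : ℕ} (μ : Ptn n) :
    Representation ℂ (Equiv.Perm (Fin n)) (spechtSub μ).toSubmodule :=
  (spechtSub μ).toRepresentation

/-- The polytabloid `e_t` as an element of `S^μ`. -/
def spechtPolytabloid {n : ℕ} {μ : Ptn n} (t : Tableau μ) : (spechtSub μ).toSubmodule :=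
  ⟨polytabloid t, Submodule.subset_span ⟨t, rfl⟩⟩

/-! ### Generalized Foulkes modules -/

/-- The reference ordered set partition `X⁰` of the `a * b` points into `b` sets of size `a`: the
point `x` lies in the block numbered `x mod b`. -/
abbrev block (a b : ℕ) (x : Fin (a * b)) : Fin b := x.modNat

/-- The wreath product `S_a ≀ S_b` with its action on the `a * b` points and on the `b` blocks:
all pairs `(g, σ)` such that `g` maps the `i`-th block to the `σ i`-th block, for each `i`. (If
`1 ≤ a`, then `g` determines `σ`, and these are the permutations that preserve the set of blocks;
keeping track of `σ` gives `S_0 ≀ S_b = S_b` for `a = 0`.) -/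
def wreath (a b : ℕ) : Subgroup (Equiv.Perm (Fin (a * b)) × Equiv.Perm (Fin b)) where
  carrier := {w | ∀ x, block a b (w.1 x) = w.2 (block a b x)}
  one_mem' _ := rfl
  mul_mem' {w w'} h h' x := by
    exact (h (w'.1 x)).trans (congrArg w.2 (h' x))
  inv_mem' {w} h x := by
    have := h (w.1⁻¹ x)
    rw [← Equiv.Perm.mul_apply, mul_inv_cancel, Equiv.Perm.one_apply] at this
    rw [Prod.snd_inv, Prod.fst_inv, this, ← Equiv.Perm.mul_apply, inv_mul_cancel,
      Equiv.Perm.one_apply]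

/-- The action homomorphism `S_a ≀ S_b → S_{ab}` (an embedding if `1 ≤ a`). -/
def wreathToPoints (a b : ℕ) : wreath a b →* Equiv.Perm (Fin (a * b)) :=
  (MonoidHom.fst _ _).comp (wreath a b).subtype

/-- The projection `S_a ≀ S_b → S_b`. -/
def wreathToBlocks (a b : ℕ) : wreath a b →* Equiv.Perm (Fin b) :=
  (MonoidHom.snd _ _).comp (wreath a b).subtype

/-- The inflation of `S^ν` along `S_a ≀ S_b → S_b`. -/
abbrev inflation (a : ℕ) {b : ℕ} (ν : Ptn b) :
    Representation ℂ (wreath a b) (spechtSub ν).toSubmodule :=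
  (specht ν).comp (wreathToBlocks a b)

/-- The generalized Foulkes module `F_ν^a`: the `S_{ab}`-module induced by the inflation of `S^ν`
to `S_a ≀ S_b`. -/
abbrev foulkes (a : ℕ) {b : ℕ} (ν : Ptn b) :
    Representation ℂ (Equiv.Perm (Fin (a * b)))
      (Representation.IndV (wreathToPoints a b) (inflation a ν)) :=
  Representation.ind (wreathToPoints a b) (inflation a ν)

/-- The element `e_{t_X}` of `F_ν^a` for the ordered set partition `X = g X⁰`. With the polytabloid
`e_t` of `S^ν` viewed in the induced module (`e_{t_X}` for `X = X⁰`), it is `g e_t`. Each ordered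
set partition into `b` sets of size `a` is of the form `g X⁰`. -/
def foulkesPolytabloid (a : ℕ) {b : ℕ} {ν : Ptn b} (g : Equiv.Perm (Fin (a * b)))
    (t : Tableau ν) : Representation.IndV (wreathToPoints a b) (inflation a ν) :=
  foulkes a ν g (Representation.IndV.mk (wreathToPoints a b) (inflation a ν) 1
    (spechtPolytabloid t))

/-! ### The components of the restriction to `S_k × S_{n-k}` -/

/-- The embedding of `S_k × S_l` in `S_n`, `n = k + l`: the first factor permutes the first `k`
points and the second one the last `l` points. -/
def young {k l n : ℕ} (h : k + l = n) :
    Equiv.Perm (Fin k) × Equiv.Perm (Fin l) →* Equiv.Perm (Fin n) :=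
  (Equiv.permCongrHom (finSumFinEquiv.trans (finCongr h))).toMonoidHom.comp
    (Equiv.Perm.sumCongrHom (Fin k) (Fin l))

/-- The restriction of `F_ν^a` to `S_k × S_l`, where `k + l = ab`. -/
abbrev foulkesRes {k l : ℕ} (a : ℕ) {b : ℕ} (ν : Ptn b) (h : k + l = a * b) :
    Representation ℂ (Equiv.Perm (Fin k) × Equiv.Perm (Fin l))
      (Representation.IndV (wreathToPoints a b) (inflation a ν)) :=
  (foulkes a ν).comp (young h)

/-- The number of elements that the `i`-th part of the ordered set partition `X = g X⁰` has among
the first `k` points. -/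
def interCard (k a b : ℕ) (g : Equiv.Perm (Fin (a * b))) (i : Fin b) : ℕ :=
  (Finset.univ.filter fun x : Fin (a * b) => block a b x = i ∧ (g x : ℕ) < k).card

/-- `X = g X⁰` belongs to `P_lam`: the nonzero sizes of the intersections of the parts of `X` with
the set of the first `k` points are the parts of the partition `lam` of `k`. -/
def InP {k : ℕ} (lam : Ptn k) (a b : ℕ) (g : Equiv.Perm (Fin (a * b))) : Prop :=
  ((Finset.univ : Finset (Fin b)).val.map (interCard k a b g)).filter (fun m => m ≠ 0) =
    (lam.1.rowLens : Multiset ℕ)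

theorem young_lt_iff {k l n : ℕ} (h : k + l = n) (y : Equiv.Perm (Fin k) × Equiv.Perm (Fin l))
    (x : Fin n) : (young h y x : ℕ) < k ↔ (x : ℕ) < k := by
  subst h
  refine Fin.addCases (fun i => ?_) (fun i => ?_) x <;> simp [young]

theorem inP_young_mul {k l a b : ℕ} (h : k + l = a * b) (lam : Ptn k)
    (y : Equiv.Perm (Fin k) × Equiv.Perm (Fin l)) (g : Equiv.Perm (Fin (a * b))) :
    InP lam a b (young h y * g) ↔ InP lam a b g := by
  have : interCard k a b (young h y * g) = interCard k a b g := by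
    funext i
    simp [interCard, young_lt_iff]
  rw [InP, InP, this]

/-- The `lam`-component `V_{ν,a}^lam` of the restriction of `F_ν^a` to `S_k × S_l`: the submodule
generated by the elements `e_{t_X}` with `X ∈ P_lam` and `t` a `ν`-tableau. (The group permutes
these elements, so it is their linear span.) -/
def component {k l : ℕ} (a : ℕ) {b : ℕ} (ν : Ptn b) (h : k + l = a * b) (lam : Ptn k) :
    Subrepresentation (foulkesRes a ν h) where
  toSubmodule := Submodule.span ℂ
    {v | ∃ (g : Equiv.Perm (Fin (a * b))) (t : Tableau ν),
      InP lam a b g ∧ v = foulkesPolytabloid a g t}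
  apply_mem_toSubmodule y v hv := by
    refine Submodule.span_induction ?_ (by simp) (fun _ _ _ _ h h' => ?_) (fun c _ _ h => ?_) hv
    · rintro _ ⟨g, t, hg, rfl⟩
      refine Submodule.subset_span ⟨young h y * g, t, (inP_young_mul h lam y g).2 hg, ?_⟩
      rw [foulkesPolytabloid, foulkesPolytabloid, map_mul]
      rfl
    · rw [map_add]; exact Submodule.add_mem _ h h'
    · rw [map_smul]; exact Submodule.smul_mem _ c h

/-- `U_{ν,a} = V_{ν,a}^{(1^b)}`, the `(1^b)`-component of the restriction of `F_ν^a` to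
`S_b × S_l`, where `b + l = ab`. -/
abbrev U {l : ℕ} (a : ℕ) {b : ℕ} (ν : Ptn b) (h : b + l = a * b) :
    Representation ℂ (Equiv.Perm (Fin b) × Equiv.Perm (Fin l))
      (component a ν h (column b)).toSubmodule :=
  (component a ν h (column b)).toRepresentation

/-- The external tensor product of a `G`-module and an `H`-module, a `G × H`-module. -/
abbrev extTensor {G H V W : Type*} [Group G] [Group H] [AddCommGroup V] [Module ℂ V]
    [AddCommGroup W] [Module ℂ W] (ρ : Representation ℂ G V) (τ : Representation ℂ H W) :
    Representation ℂ (G × H) (V ⊗[ℂ] W) :=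
  Representation.tprod (ρ.comp (MonoidHom.fst G H)) (τ.comp (MonoidHom.snd G H))

theorem add_pred_mul {a : ℕ} (b : ℕ) (ha : 1 ≤ a) : b + (a - 1) * b = a * b := by
  obtain ⟨c, rfl⟩ := Nat.exists_eq_add_of_le ha
  rw [Nat.add_sub_cancel_left]
  ring

end GenFoulkes

end

open GenFoulkes

/-! Write $c=a-1$ and $K=S_b\times S_{cb}$. The ordered set partitions whose parts each contain
exactly one of the first $b$ points form one $K$-orbit, up to renumbering the parts, and renumbering
changes $e_{t_X}$ only by a sign because $S^{(1^b)}$ is the sign module. So $U_{(1^b),a}$ is the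
cyclic $K$-module generated by $E=e_{t_{X^0}}$ (`component_column`). The elements of $K$ that
respect the blocks of $X^0$ form a copy of $S_c\wr S_b$, with $w$ acting on the first $b$ points as
it acts on blocks (`young_mem_wreath_iff`), and they act on $E$ by the sign of the block
permutation. Thus $U_{(1^b),a}$ is this sign character induced to $K$.

Inducing in stages, through $S_b\times(S_c\wr S_b)$, gives first the functions on $S_b$ with the
sign-twisted two-sided action. By Peter–Weyl and $S^{\lambda^\perp}\cong
S^\lambda\otimes\mathrm{sgn}$ this is $\bigoplus S^{\lambda^\perp}\otimes S^\lambda$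
(`exists_signed_peterWeyl`). Inducing the second factor turns $S^\lambda$ into $F_\lambda^{c}$. In
place of an abstract Mackey formula there are two explicit equivariant maps: $\alpha$ from the
direct sum to $F_{(1^b)}^a$, with image generated by $E$, and $\beta$ backwards, an average over $K$
and the wreath product (`mackeyMap`). As $\beta\alpha$ is a nonzero scalar, $\alpha$ is injective
(`nonempty_equiv_sumInd`).

Peter–Weyl is proved with James's signed column sums. Such a sum kills $M^\mu$ unless its shape
dominates $\mu$, and has rank one on its own $M^\lambda$, so the matrix coefficients of the Specht
modules are independent. They fill the function space because there are at least as many partitions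
as conjugacy classes. -/

noncomputable section

namespace Representation

/-! ### Maps out of induced modules and the averaging map -/

section Induced

variable {G H : Type*} [Group G] [Group H] (φ : G →* H) {A B : Type*}
  [AddCommGroup A] [Module ℂ A] (ρ : Representation ℂ G A) [AddCommGroup B] [Module ℂ B]

/-- A linear map out of an induced module is given by its values on the generators. -/
def liftIndV (T : H → A →ₗ[ℂ] B) (hT : ∀ w h a, T (φ w * h) (ρ w a) = T h a) :
    IndV φ ρ →ₗ[ℂ] B :=
  Coinvariants.lift _ (TensorProduct.lift <| (Finsupp.lift _ _ _ T) ∘ₗ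
      (MonoidAlgebra.coeffLinearEquiv ℂ).toLinearMap)
    fun g ↦ by
      ext h x
      simpa using hT g h x

@[simp]
theorem liftIndV_mk (T : H → A →ₗ[ℂ] B) (hT : ∀ w h a, T (φ w * h) (ρ w a) = T h a) (h : H)
    (a : A) : liftIndV φ ρ T hT (IndV.mk φ ρ h a) = T h a := by
  simp [liftIndV]

theorem ind_mk' (g h : H) (a : A) :
    ind φ ρ g (IndV.mk φ ρ h a) = IndV.mk φ ρ (h * g⁻¹) a :=
  ind_mk φ ρ g h a

theorem mk_eq_ind (h : H) (a : A) :
    IndV.mk φ ρ h a = ind φ ρ h⁻¹ (IndV.mk φ ρ 1 a) := by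
  rw [ind_mk', inv_inv, one_mul]

theorem mk_mul_act (w : G) (h : H) (a : A) :
    IndV.mk φ ρ (φ w * h) (ρ w a) = IndV.mk φ ρ h a := by
  have := Coinvariants.mk_self_apply
    (Representation.tprod ((leftRegular ℂ H).comp φ) ρ) w (MonoidAlgebra.single h 1 ⊗ₜ a)
  simpa using this

theorem mk_one_act (w : G) (a : A) :
    IndV.mk φ ρ 1 (ρ w a) = ind φ ρ (φ w) (IndV.mk φ ρ 1 a) := by
  rw [ind_mk', one_mul, ← mk_mul_act φ ρ w (φ w)⁻¹, mul_inv_cancel]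

/-- Linear maps out of an induced module agree if they agree on the generators. -/
theorem indV_hom_ext {f g : IndV φ ρ →ₗ[ℂ] B}
    (h : ∀ (x : H) (a : A), f (IndV.mk φ ρ x a) = g (IndV.mk φ ρ x a)) : f = g :=
  IndV.hom_ext φ ρ fun x => LinearMap.ext fun a => h x a

variable {K : Type*} [Group K] [Fintype G] [Fintype K] (j : K →* H) (τ : Representation ℂ K B)

open scoped Classical in
/-- Averaging over `K` and `G`: a map from the restriction to `K` of a module induced from `G`. -/
def mackeyMap (χ : G →* ℂ) (c : A →ₗ[ℂ] ℂ) (hc : ∀ w v, c (ρ w v) = χ w * c v) (e : B) :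
    IndV φ ρ →ₗ[ℂ] B :=
  liftIndV φ ρ (fun h => c.smulRight
      (∑ k : K, ∑ w : G, if j k * φ w * h = 1 then χ w • τ k e else 0)) fun w₀ h a => by
    simp only [LinearMap.smulRight_apply, hc, mul_comm (χ w₀) (c a), mul_smul]
    congr 1
    rw [Finset.smul_sum]
    refine Finset.sum_congr rfl fun k _ => ?_
    rw [Finset.smul_sum]
    -- Replacing $w$ by $ww_0$ absorbs $\varphi(w_0)$ in the condition and produces the factor
    -- $\chi(w_0)$.
    refine Fintype.sum_equiv (Equiv.mulRight w₀) _ _ fun w => ?_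
    simp only [Equiv.coe_mulRight, map_mul, mul_assoc, smul_ite, smul_zero, smul_smul,
      mul_comm (χ w₀)]

variable (χ : G →* ℂ) (c : A →ₗ[ℂ] ℂ) (hc : ∀ w v, c (ρ w v) = χ w * c v) (e : B)

theorem mackeyMap_equivariant (k₀ : K) (x : IndV φ ρ) :
    mackeyMap φ ρ j τ χ c hc e (ind φ ρ (j k₀) x) = τ k₀ (mackeyMap φ ρ j τ χ c hc e x) := by
  classical
  refine LinearMap.congr_fun (f := mackeyMap φ ρ j τ χ c hc e ∘ₗ ind φ ρ (j k₀))
    (g := τ k₀ ∘ₗ mackeyMap φ ρ j τ χ c hc e) (indV_hom_ext φ ρ fun h a => ?_) x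
  change mackeyMap φ ρ j τ χ c hc e (ind φ ρ (j k₀) (IndV.mk φ ρ h a)) =
    τ k₀ (mackeyMap φ ρ j τ χ c hc e (IndV.mk φ ρ h a))
  rw [ind_mk', mackeyMap, liftIndV_mk, liftIndV_mk,
    LinearMap.smulRight_apply, LinearMap.smulRight_apply, map_smul, map_sum]
  congr 1
  refine Fintype.sum_equiv (Equiv.mulLeft k₀⁻¹) _ _ fun k => ?_
  rw [map_sum]
  refine Finset.sum_congr rfl fun w _ => ?_
  have : j (k₀⁻¹ * k) * φ w * h = 1 ↔ j k * φ w * (h * (j k₀)⁻¹) = 1 := by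
    rw [← mul_assoc, mul_inv_eq_one, map_mul, map_inv, mul_assoc, mul_assoc, inv_mul_eq_one,
      mul_assoc, eq_comm]
  simp only [Equiv.coe_mulLeft, this]
  split_ifs
  · rw [map_smul, ← Module.End.mul_apply, ← map_mul, mul_inv_cancel_left]
  · rw [map_zero]

/-- For $h=1$ only pairs with $j(k)=\varphi(w)^{-1}$ contribute, and by `he` each of them
contributes exactly $e$. So $N$ is the number of such pairs, nonzero because the pair $(1,1)$
occurs. -/
theorem mackeyMap_mk_one (he : ∀ k w, j k = φ w → τ k e = χ w • e) :
    ∃ N : ℂ, N ≠ 0 ∧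
      ∀ v, mackeyMap φ ρ j τ χ c hc e (IndV.mk φ ρ 1 v) = (N * c v) • e := by
  classical
  refine ⟨((Finset.univ.filter fun p : K × G => j p.1 * φ p.2 = 1).card : ℂ), ?_, fun v => ?_⟩
  · rw [Nat.cast_ne_zero]
    exact (Finset.card_pos.2 ⟨1, by simp⟩).ne'
  · rw [mackeyMap, liftIndV_mk, LinearMap.smulRight_apply, mul_comm, mul_smul]
    congr 1
    have : ∀ (k : K) (w : G), (if j k * φ w * 1 = 1 then χ w • τ k e else 0) =
        if j k * φ w = 1 then e else 0 := by
      intro k w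
      rw [mul_one]
      split_ifs with h
      · rw [he k w⁻¹ (by rw [map_inv]; exact eq_inv_of_mul_eq_one_left h), smul_smul, ← map_mul,
          mul_inv_cancel, map_one, one_smul]
      · rfl
    simp only [this]
    rw [← Fintype.sum_prod_type' (f := fun k w => if j k * φ w = 1 then e else 0),
      ← Finset.sum_filter, Finset.sum_const, Nat.cast_smul_eq_nsmul]

end Induced

end Representation

namespace Representation

/-! ### Induction in stages through the twisted regular module of `A` -/

section TwistedRegular

variable {A L W : Type*} [Group A] [Group L] [Group W] (φ : W →* L) (ψ : W →* A)
  {ι : Type*} [DecidableEq ι] {X Y : ι → Type*}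
  [∀ i, AddCommGroup (X i)] [∀ i, Module ℂ (X i)] [∀ i, AddCommGroup (Y i)] [∀ i, Module ℂ (Y i)]
  (ξ : ∀ i, Representation ℂ A (X i)) (η : ∀ i, Representation ℂ A (Y i))

/-- The direct sum of the external tensor products of the `X i` and the `Y i`. -/
abbrev sumExt : Representation ℂ (A × A) (⨁ i, X i ⊗[ℂ] Y i) :=
  directSum fun i => extTensor (ξ i) (η i)

/-- The direct sum of the external tensor products of the `X i` and the modules induced by the
`Y i`. -/
abbrev sumInd : Representation ℂ (A × L) (⨁ i, X i ⊗[ℂ] IndV φ ((η i).comp ψ)) :=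
  directSum fun i => extTensor (ξ i) (ind φ ((η i).comp ψ))

/-- The canonical map from the `X i ⊗ Y i` to the induced modules. -/
def toSumInd : (⨁ i, X i ⊗[ℂ] Y i) →ₗ[ℂ] ⨁ i, X i ⊗[ℂ] IndV φ ((η i).comp ψ) :=
  DirectSum.lmap fun i => (IndV.mk φ ((η i).comp ψ) 1).lTensor (X i)

theorem toSumInd_lof (i : ι) (u : X i) (v : Y i) :
    toSumInd (X := X) φ ψ η (DirectSum.lof ℂ ι (fun i => X i ⊗[ℂ] Y i) i (u ⊗ₜ v)) =
      DirectSum.lof ℂ ι _ i (u ⊗ₜ IndV.mk φ ((η i).comp ψ) 1 v) := by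
  rw [toSumInd, DirectSum.lmap_lof, LinearMap.lTensor_tmul]

theorem sumExt_lof (g : A × A) (i : ι) (u : X i) (v : Y i) :
    sumExt ξ η g (DirectSum.lof ℂ ι (fun i => X i ⊗[ℂ] Y i) i (u ⊗ₜ v)) =
      DirectSum.lof ℂ ι (fun i => X i ⊗[ℂ] Y i) i (ξ i g.1 u ⊗ₜ η i g.2 v) := by
  rw [directSum_apply, DirectSum.lmap_lof, tprod_apply, TensorProduct.map_tmul]
  rfl

theorem sumInd_lof (g : A × L) (i : ι) (u : X i) (x : IndV φ ((η i).comp ψ)) :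
    sumInd φ ψ ξ η g
        (DirectSum.lof ℂ ι (fun i => X i ⊗[ℂ] IndV φ ((η i).comp ψ)) i (u ⊗ₜ x)) =
      DirectSum.lof ℂ ι (fun i => X i ⊗[ℂ] IndV φ ((η i).comp ψ)) i
        (ξ i g.1 u ⊗ₜ ind φ ((η i).comp ψ) g.2 x) := by
  rw [directSum_apply, DirectSum.lmap_lof, tprod_apply, TensorProduct.map_tmul]
  rfl

variable {F : Type*} [AddCommGroup F] [Module ℂ F]

theorem sumExt_hom_ext {B : Type*} [AddCommMonoid B] [Module ℂ B]
    {f f' : (⨁ i, X i ⊗[ℂ] Y i) →ₗ[ℂ] B}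
    (h : ∀ i (u : X i) (v : Y i), f (DirectSum.lof ℂ ι (fun i => X i ⊗[ℂ] Y i) i (u ⊗ₜ v)) =
      f' (DirectSum.lof ℂ ι (fun i => X i ⊗[ℂ] Y i) i (u ⊗ₜ v))) : f = f' :=
  DirectSum.linearMap_ext ℂ fun i => TensorProduct.ext' fun u v => h i u v

/-- The $L$-translates of the image of $\bigoplus X_i\otimes Y_i$ span, since $y\otimes v$ is the
translate by $y^{-1}$ of $1\otimes v$. -/
theorem sumInd_hom_ext {f f' : (⨁ i, X i ⊗[ℂ] IndV φ ((η i).comp ψ)) →ₗ[ℂ] F}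
    (h : ∀ y q, f (sumInd φ ψ ξ η (1, y) (toSumInd φ ψ η q)) =
      f' (sumInd φ ψ ξ η (1, y) (toSumInd φ ψ η q))) : f = f' := by
  refine DirectSum.linearMap_ext ℂ fun i => TensorProduct.ext (LinearMap.ext fun u =>
    indV_hom_ext φ _ fun y v => ?_)
  have := h y⁻¹ (DirectSum.lof ℂ ι (fun i => X i ⊗[ℂ] Y i) i (u ⊗ₜ v))
  rw [toSumInd_lof, sumInd_lof] at this
  dsimp only at this
  rw [map_one, ← mk_eq_ind] at this
  exact this

theorem sumInd_toSumInd_left (g : A) (q : ⨁ i, X i ⊗[ℂ] Y i) :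
    sumInd φ ψ ξ η (g, 1) (toSumInd φ ψ η q) = toSumInd φ ψ η (sumExt ξ η (g, 1) q) := by
  refine LinearMap.congr_fun (f := sumInd φ ψ ξ η (g, 1) ∘ₗ toSumInd φ ψ η)
    (g := toSumInd φ ψ η ∘ₗ sumExt ξ η (g, 1)) (sumExt_hom_ext fun i u v => ?_) q
  rw [LinearMap.comp_apply, LinearMap.comp_apply, toSumInd_lof, sumInd_lof, sumExt_lof,
    toSumInd_lof]
  simp only [map_one, Module.End.one_apply]

theorem sumInd_toSumInd_diag (w : W) (q : ⨁ i, X i ⊗[ℂ] Y i) :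
    sumInd φ ψ ξ η (ψ w, φ w) (toSumInd φ ψ η q) =
      toSumInd φ ψ η (sumExt ξ η (ψ w, ψ w) q) := by
  refine LinearMap.congr_fun (f := sumInd φ ψ ξ η (ψ w, φ w) ∘ₗ toSumInd φ ψ η)
    (g := toSumInd φ ψ η ∘ₗ sumExt ξ η (ψ w, ψ w)) (sumExt_hom_ext fun i u v => ?_) q
  rw [LinearMap.comp_apply, LinearMap.comp_apply, toSumInd_lof, sumInd_lof, sumExt_lof,
    toSumInd_lof, ← mk_one_act]
  rfl

theorem prod_split (ρ : Representation ℂ (A × L) F) (g : A) (y : L) (v : F) :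
    ρ (1, y) (ρ (g, 1) v) = ρ (g, y) v := by
  rw [← Module.End.mul_apply, ← map_mul, Prod.mk_mul_mk, one_mul, mul_one]

variable [Fintype A] (χ : A →* ℂ) (ρ : Representation ℂ (A × L) F) (E : F)

/-- The map from functions on `A` to `F` given by the `A`-orbit of the vector `E`. -/
def orbitMap : (A → ℂ) →ₗ[ℂ] F :=
  ∑ g : A, (LinearMap.proj g).smulRight (χ g • ρ (g, 1) E)

theorem orbitMap_apply (f : A → ℂ) : orbitMap χ ρ E f = ∑ g, f g • χ g • ρ (g, 1) E := by
  simp [orbitMap]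

/-- This is the relation that lets the orbit map descend to the induced modules: right translation
by $\psi(w)$ is undone by $\varphi(w)^{-1}$, because the diagonal element $(\psi(w),\varphi(w))$
only scales $E$. -/
theorem orbitMap_right (hχ : ∀ g, χ g * χ g = 1)
    (hE : ∀ w, ρ (ψ w, φ w) E = χ (ψ w) • E) (w : W) (f : A → ℂ) :
    ρ (1, (φ w)⁻¹) (orbitMap χ ρ E fun g => f (g * ψ w)) = orbitMap χ ρ E f := by
  rw [orbitMap_apply, orbitMap_apply, map_sum]
  refine Fintype.sum_equiv (Equiv.mulRight (ψ w)) _ _ fun g => ?_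
  have h₁ : ρ (g * ψ w, 1) E = χ (ψ w) • ρ (g, (φ w)⁻¹) E := by
    rw [← map_smul, ← hE, ← Module.End.mul_apply, ← map_mul, Prod.mk_mul_mk, inv_mul_cancel]
  rw [Equiv.coe_mulRight, h₁, map_smul, map_smul, prod_split, map_mul,
    smul_smul (χ g * _), mul_assoc, hχ, mul_one]

theorem orbitMap_left (hχ : ∀ g, χ g * χ g = 1) (h : A) (f : A → ℂ) :
    orbitMap χ ρ E (fun g => χ h * f (h⁻¹ * g)) = ρ (h, 1) (orbitMap χ ρ E f) := by
  rw [orbitMap_apply, orbitMap_apply, map_sum]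
  refine Fintype.sum_equiv (Equiv.mulLeft h⁻¹) _ _ fun g => ?_
  have h₁ : χ (h⁻¹ * g) = χ h * χ g := by
    rw [map_mul]
    congr 1
    have : χ h⁻¹ * χ h = 1 := by rw [← map_mul, inv_mul_cancel, map_one]
    calc χ h⁻¹ = χ h⁻¹ * (χ h * χ h) := by rw [hχ, mul_one]
      _ = χ h := by rw [← mul_assoc, this, one_mul]
  rw [Equiv.coe_mulLeft]
  dsimp only
  rw [h₁, map_smul, map_smul, ← Module.End.mul_apply, ← map_mul ρ, Prod.mk_mul_mk,
    mul_inv_cancel_left, one_mul, smul_smul, smul_smul]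
  congr 1
  ring

/-- The component at `i` of the map `fromSumInd`, on the elements `y ⊗ v` of an induced module. -/
def fromIndAux (Φ : (⨁ i, X i ⊗[ℂ] Y i) →ₗ[ℂ] (A → ℂ)) (i : ι) (y : L) :
    Y i →ₗ[ℂ] X i →ₗ[ℂ] F :=
  ((TensorProduct.mk ℂ (X i) (Y i)).compr₂
    (ρ (1, y⁻¹) ∘ₗ orbitMap χ ρ E ∘ₗ Φ ∘ₗ DirectSum.lof ℂ ι (fun i => X i ⊗[ℂ] Y i) i)).flip

theorem fromIndAux_apply (Φ : (⨁ i, X i ⊗[ℂ] Y i) →ₗ[ℂ] (A → ℂ)) (i : ι) (y : L) (v : Y i)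
    (u : X i) : fromIndAux χ ρ E Φ i y v u =
      ρ (1, y⁻¹) (orbitMap χ ρ E (Φ (DirectSum.lof ℂ ι (fun i => X i ⊗[ℂ] Y i) i (u ⊗ₜ v)))) :=
  rfl

variable (Φ : (⨁ i, X i ⊗[ℂ] Y i) →ₗ[ℂ] (A → ℂ))
  (hΦ : ∀ h k q g, Φ (sumExt ξ η (h, k) q) g = χ h * Φ q (h⁻¹ * g * k))
  (hχ : ∀ g, χ g * χ g = 1) (hE : ∀ w, ρ (ψ w, φ w) E = χ (ψ w) • E)

/-- The map from the sum of the tensor products `X i ⊗ Ind (Y i)` to `F` given by the identification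
`Φ` of the sum of the `X i ⊗ Y i` with the functions on `A` and by the orbit of `E`. -/
def fromSumInd : (⨁ i, X i ⊗[ℂ] IndV φ ((η i).comp ψ)) →ₗ[ℂ] F :=
  DirectSum.toModule ℂ ι F fun i => TensorProduct.lift
    (liftIndV φ ((η i).comp ψ) (fromIndAux χ ρ E Φ i) fun w y v => LinearMap.ext fun u => by
      have h₁ : sumExt ξ η (1, ψ w) (DirectSum.lof ℂ ι (fun i => X i ⊗[ℂ] Y i) i (u ⊗ₜ v)) =
          DirectSum.lof ℂ ι (fun i => X i ⊗[ℂ] Y i) i (u ⊗ₜ η i (ψ w) v) := by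
        rw [sumExt_lof, map_one, Module.End.one_apply]
      have h₂ : Φ (DirectSum.lof ℂ ι (fun i => X i ⊗[ℂ] Y i) i (u ⊗ₜ η i (ψ w) v)) = fun g =>
          Φ (DirectSum.lof ℂ ι (fun i => X i ⊗[ℂ] Y i) i (u ⊗ₜ v)) (g * ψ w) := by
        funext g
        rw [← h₁, hΦ, map_one, one_mul, inv_one, one_mul]
      have h₃ : ρ (1, (φ w * y)⁻¹) = ρ (1, y⁻¹) * ρ (1, (φ w)⁻¹) := by
        rw [← map_mul, Prod.mk_mul_mk, one_mul, mul_inv_rev]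
      rw [fromIndAux_apply, fromIndAux_apply, MonoidHom.comp_apply, h₂, h₃, Module.End.mul_apply,
        orbitMap_right φ ψ χ ρ E hχ hE]).flip

theorem fromSumInd_apply (y : L) (q : ⨁ i, X i ⊗[ℂ] Y i) :
    fromSumInd φ ψ ξ η χ ρ E Φ hΦ hχ hE (sumInd φ ψ ξ η (1, y) (toSumInd φ ψ η q)) =
      ρ (1, y) (orbitMap χ ρ E (Φ q)) := by
  refine LinearMap.congr_fun (f := fromSumInd φ ψ ξ η χ ρ E Φ hΦ hχ hE ∘ₗ
      sumInd φ ψ ξ η (1, y) ∘ₗ toSumInd φ ψ η)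
    (g := ρ (1, y) ∘ₗ orbitMap χ ρ E ∘ₗ Φ) (sumExt_hom_ext fun i u v => ?_) q
  have h : fromSumInd φ ψ ξ η χ ρ E Φ hΦ hχ hE
      (DirectSum.lof ℂ ι (fun i => X i ⊗[ℂ] IndV φ ((η i).comp ψ)) i
        (u ⊗ₜ IndV.mk φ ((η i).comp ψ) y⁻¹ v)) = fromIndAux χ ρ E Φ i y⁻¹ v u := by
    rw [fromSumInd, DirectSum.toModule_lof, TensorProduct.lift.tmul, LinearMap.flip_apply,
      liftIndV_mk]
  rw [mk_eq_ind, inv_inv, fromIndAux_apply, inv_inv] at h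
  simp only [LinearMap.comp_apply]
  rw [toSumInd_lof, sumInd_lof]
  dsimp only
  rw [map_one, ← h]
  rfl

theorem fromSumInd_equivariant (k : A × L) (z : ⨁ i, X i ⊗[ℂ] IndV φ ((η i).comp ψ)) :
    fromSumInd φ ψ ξ η χ ρ E Φ hΦ hχ hE (sumInd φ ψ ξ η k z) =
      ρ k (fromSumInd φ ψ ξ η χ ρ E Φ hΦ hχ hE z) := by
  obtain ⟨h, x⟩ := k
  refine LinearMap.congr_fun (f := fromSumInd φ ψ ξ η χ ρ E Φ hΦ hχ hE ∘ₗ sumInd φ ψ ξ η (h, x))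
    (g := ρ (h, x) ∘ₗ fromSumInd φ ψ ξ η χ ρ E Φ hΦ hχ hE)
    (sumInd_hom_ext φ ψ ξ η fun y q => ?_) z
  have h₁ : sumInd φ ψ ξ η (h, x) (sumInd φ ψ ξ η (1, y) (toSumInd φ ψ η q)) =
      sumInd φ ψ ξ η (1, x * y) (toSumInd φ ψ η (sumExt ξ η (h, 1) q)) := by
    rw [← sumInd_toSumInd_left, prod_split, ← Module.End.mul_apply, ← map_mul, Prod.mk_mul_mk,
      mul_one]
  have h₂ : Φ (sumExt ξ η (h, 1) q) = fun g => χ h * Φ q (h⁻¹ * g) := by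
    funext g
    rw [hΦ, mul_one]
  rw [LinearMap.comp_apply, LinearMap.comp_apply, h₁, fromSumInd_apply, fromSumInd_apply, h₂,
    orbitMap_left χ ρ E hχ, prod_split, ← Module.End.mul_apply, ← map_mul, Prod.mk_mul_mk, mul_one]

/-- If functions on `A` are identified with the sum of the `X i ⊗ Y i`, and if `F` has a map to
`⨁ X i ⊗ Ind (Y i)` that sends `E` to a multiple of the generator, then `⨁ X i ⊗ Ind (Y i)`
is isomorphic to the submodule of `F` generated by `E`. -/
theorem nonempty_equiv_sumInd [DecidableEq A] (Φ : (⨁ i, X i ⊗[ℂ] Y i) ≃ₗ[ℂ] (A → ℂ))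
    (hΦ : ∀ h k q g, Φ (sumExt ξ η (h, k) q) g = χ h * Φ q (h⁻¹ * g * k))
    (hχ : ∀ g, χ g * χ g = 1) (hE : ∀ w, ρ (ψ w, φ w) E = χ (ψ w) • E)
    (β : F →ₗ[ℂ] ⨁ i, X i ⊗[ℂ] IndV φ ((η i).comp ψ))
    (hβ : ∀ k v, β (ρ k v) = sumInd φ ψ ξ η k (β v)) (N : ℂ) (hN : N ≠ 0)
    (hβE : β E = N • toSumInd φ ψ η (Φ.symm (Pi.single 1 1)))
    (P : Subrepresentation ρ)
    (hP : P.toSubmodule = Submodule.span ℂ (Set.range fun k => ρ k E)) :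
    Nonempty (P.toRepresentation.Equiv (sumInd φ ψ ξ η)) := by
  set α := fromSumInd φ ψ ξ η χ ρ E Φ.toLinearMap hΦ hχ hE with hα
  have hαy (y q) : α (sumInd φ ψ ξ η (1, y) (toSumInd φ ψ η q)) =
      ρ (1, y) (orbitMap χ ρ E (Φ q)) :=
    fromSumInd_apply φ ψ ξ η χ ρ E Φ.toLinearMap hΦ hχ hE y q
  have hαk (k z) : α (sumInd φ ψ ξ η k z) = ρ k (α z) :=
    fromSumInd_equivariant φ ψ ξ η χ ρ E Φ.toLinearMap hΦ hχ hE k z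
  have hβT (f) : β (orbitMap χ ρ E f) = N • toSumInd φ ψ η (Φ.symm f) := by
    -- Every function is a combination of left translates of $\delta_1$; the second factor $\chi(g)$
    -- cancels the twist. So equivariance and the value of $\beta$ at $E$ determine $\beta$ on the
    -- whole $A$-orbit.
    have h₁ : f = Φ (∑ g, f g • χ g • sumExt ξ η (g, 1) (Φ.symm (Pi.single 1 1))) := by
      funext x
      simp only [map_sum, map_smul, Finset.sum_apply, Pi.smul_apply, smul_eq_mul, hΦ,
        LinearEquiv.apply_symm_apply, mul_one, ← mul_assoc (χ _), hχ, one_mul, Pi.single_apply,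
        inv_mul_eq_one]
      simp
    conv_rhs => rw [h₁, LinearEquiv.symm_apply_apply]
    rw [orbitMap_apply, map_sum, map_sum, Finset.smul_sum]
    refine Finset.sum_congr rfl fun g _ => ?_
    rw [map_smul, map_smul, hβ, hβE, map_smul, map_smul, map_smul, sumInd_toSumInd_left,
      smul_comm N, smul_comm N]
  have hβα (z) : β (α z) = N • z := by
    refine LinearMap.congr_fun (f := β ∘ₗ α) (g := N • LinearMap.id)
      (sumInd_hom_ext φ ψ ξ η fun y q => ?_) z
    rw [LinearMap.comp_apply, hαy, hβ, hβT, LinearEquiv.symm_apply_apply, map_smul]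
    rfl
  have hinj : Function.Injective α := fun z z' h =>
    smul_right_injective _ hN (by simpa only [hβα] using congrArg β h)
  -- The orbit map sends $\delta_1$ to $E$, so $E$ lies in the image of $\alpha$.
  have hαE : α (toSumInd φ ψ η (Φ.symm (Pi.single 1 1))) = E := by
    have := hαy 1 (Φ.symm (Pi.single 1 1))
    rw [← Prod.one_eq_mk, map_one, map_one, Module.End.one_apply, Module.End.one_apply,
      LinearEquiv.apply_symm_apply, orbitMap_apply] at this
    rw [this, Finset.sum_eq_single 1]
    · rw [Pi.single_eq_same, one_smul, map_one, one_smul, ← Prod.one_eq_mk, map_one,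
        Module.End.one_apply]
    · intro g _ hg
      rw [Pi.single_eq_of_ne hg, zero_smul]
    · simp
  have hrange : LinearMap.range α = P.toSubmodule := by
    rw [hP]
    refine le_antisymm ?_ (Submodule.span_le.2 ?_)
    · have : ∀ z, α z ∈ Submodule.span ℂ (Set.range fun k => ρ k E) := by
        intro z
        refine (Submodule.Quotient.mk_eq_zero _).1 ?_
        refine LinearMap.congr_fun (f := Submodule.mkQ _ ∘ₗ α) (g := 0)
          (sumInd_hom_ext φ ψ ξ η fun y q => ?_) z
        refine (Submodule.Quotient.mk_eq_zero _).2 ?_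
        rw [hαy, orbitMap_apply, map_sum]
        refine Submodule.sum_mem _ fun g _ => ?_
        rw [map_smul, map_smul, prod_split]
        exact Submodule.smul_mem _ _ (Submodule.smul_mem _ _ (Submodule.subset_span ⟨_, rfl⟩))
      rintro _ ⟨z, rfl⟩
      exact this z
    · rintro _ ⟨k, rfl⟩
      exact ⟨sumInd φ ψ ξ η k (toSumInd φ ψ η (Φ.symm (Pi.single 1 1))), by rw [hαk, hαE]⟩
  refine ⟨(Equiv.mk ((LinearEquiv.ofInjective α hinj).trans (LinearEquiv.ofEq _ _ hrange))
    fun k => LinearMap.ext fun z => Subtype.ext ?_).symm⟩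
  exact hαk k z

end TwistedRegular

end Representation

/-! ### James's theory of tabloids and signed column sums -/

namespace GenFoulkes

variable {n : ℕ}

instance (μ : Ptn n) : Finite (Tabloid μ) := Quotient.finite _

instance (μ : Ptn n) : Fintype (Tabloid μ) := Fintype.ofFinite _

theorem card_cells (μ : Ptn n) : Fintype.card {c : ℕ × ℕ // c ∈ μ.1.cells} = n := by
  rw [Fintype.card_coe]
  exact μ.2

instance (μ : Ptn n) : Nonempty (Tableau μ) :=
  ⟨Fintype.equivOfCardEq (by rw [card_cells, Fintype.card_fin])⟩

instance (μ : Ptn n) : Fintype (Tableau μ) := Fintype.ofFinite _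

theorem tableau_ext {μ : Ptn n} (t : Tableau μ) {x y : Fin n} (hr : t.row x = t.row y)
    (hc : t.col x = t.col y) : x = y :=
  t.injective (Subtype.ext (Prod.ext hr hc))

theorem exists_act_eq {μ : Ptn n} (t s : Tableau μ) : ∃ σ : Equiv.Perm (Fin n), t.act σ = s :=
  ⟨t.trans s.symm, Equiv.ext fun x => by simp [Tableau.act]⟩

theorem Tabloid.ind {μ : Ptn n} {p : Tabloid μ → Prop} (h : ∀ t, p (Tabloid.mk t)) (T) : p T :=
  Quotient.ind h T

/-! ### The dot product on tabloids -/

/-- The bilinear form on `M^μ` for which the tabloids are an orthonormal basis. -/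
def dot (μ : Ptn n) :
    MonoidAlgebra ℂ (Tabloid μ) →ₗ[ℂ] MonoidAlgebra ℂ (Tabloid μ) →ₗ[ℂ] ℂ :=
  LinearMap.mk₂ ℂ (fun u v => ∑ T, u.coeff T * v.coeff T)
    (fun u u' v => by simp [add_mul, Finset.sum_add_distrib])
    (fun c u v => by simp [Finset.mul_sum, mul_assoc])
    (fun u v v' => by simp [mul_add, Finset.sum_add_distrib])
    (fun c u v => by simp [Finset.mul_sum, mul_left_comm])

theorem dot_apply (μ : Ptn n) (u v : MonoidAlgebra ℂ (Tabloid μ)) :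
    dot μ u v = ∑ T, u.coeff T * v.coeff T := rfl

theorem dot_comm (μ : Ptn n) (u v : MonoidAlgebra ℂ (Tabloid μ)) : dot μ u v = dot μ v u := by
  simp only [dot_apply, mul_comm]

theorem dot_single (μ : Ptn n) (T : Tabloid μ) (v : MonoidAlgebra ℂ (Tabloid μ)) :
    dot μ (MonoidAlgebra.single T 1) v = v.coeff T := by
  classical
  rw [dot_apply, Finset.sum_eq_single T]
  · simp
  · intro S _ hS
    simp [hS.symm]
  · simp

theorem dot_act (μ : Ptn n) (σ : Equiv.Perm (Fin n)) (u v : MonoidAlgebra ℂ (Tabloid μ)) :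
    dot μ (tabloidModule μ σ u) (tabloidModule μ σ v) = dot μ u v := by
  rw [dot_apply, dot_apply]
  refine Fintype.sum_equiv (MulAction.toPerm σ⁻¹) _ _ fun T => ?_
  rw [Representation.coeff_ofMulAction, Representation.coeff_ofMulAction]
  rfl

theorem dot_act_left (μ : Ptn n) (σ : Equiv.Perm (Fin n)) (u v : MonoidAlgebra ℂ (Tabloid μ)) :
    dot μ (tabloidModule μ σ u) v = dot μ u (tabloidModule μ σ⁻¹ v) := by
  rw [← dot_act μ σ u, ← Module.End.mul_apply, ← map_mul, mul_inv_cancel, map_one,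
    Module.End.one_apply]

/-! ### Signed column sums -/

/-- The sign of a permutation, as a complex number. -/
def sgn : Equiv.Perm (Fin n) →* ℂ :=
  (Int.castRingHom ℂ : ℤ →* ℂ).comp ((Units.coeHom ℤ).comp Equiv.Perm.sign)

theorem sgn_apply (σ : Equiv.Perm (Fin n)) : sgn σ = ((Equiv.Perm.sign σ : ℤ) : ℂ) := rfl

theorem sgn_mul_self (σ : Equiv.Perm (Fin n)) : sgn σ * sgn σ = 1 := by
  rw [sgn_apply, ← Int.cast_mul, Int.units_coe_mul_self, Int.cast_one]

theorem sgn_inv (σ : Equiv.Perm (Fin n)) : sgn σ⁻¹ = sgn σ := by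
  rw [sgn_apply, sgn_apply, Equiv.Perm.sign_inv]

variable {V : Type*} [AddCommGroup V] [Module ℂ V]

open scoped Classical in
/-- The signed sum over the column stabilizer of `t`, as an operator on a representation. -/
def columnSum {lam : Ptn n} (t : Tableau lam) (ρ : Representation ℂ (Equiv.Perm (Fin n)) V) :
    V →ₗ[ℂ] V :=
  ∑ π : colStab t, sgn π.1 • ρ π.1

open scoped Classical in
theorem columnSum_apply {lam : Ptn n} (t : Tableau lam)
    (ρ : Representation ℂ (Equiv.Perm (Fin n)) V) (v : V) :
    columnSum t ρ v = ∑ π : colStab t, sgn π.1 • ρ π.1 v := by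
  rw [columnSum, LinearMap.sum_apply]
  rfl

theorem columnSum_single {lam : Ptn n} (t : Tableau lam) :
    columnSum t (tabloidModule lam) (MonoidAlgebra.single (Tabloid.mk t) 1) = polytabloid t := by
  classical
  rw [columnSum_apply, polytabloid]
  refine Fintype.sum_equiv (Equiv.refl _) _ _ fun π => ?_
  rw [Representation.ofMulAction_single, smul_mk]
  rfl

theorem columnSum_act {lam : Ptn n} (t : Tableau lam)
    (ρ : Representation ℂ (Equiv.Perm (Fin n)) V) {τ : Equiv.Perm (Fin n)} (hτ : τ ∈ colStab t)
    (v : V) : columnSum t ρ (ρ τ v) = sgn τ • columnSum t ρ v := by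
  classical
  rw [columnSum_apply, columnSum_apply, Finset.smul_sum]
  refine Fintype.sum_equiv (Equiv.mulRight ⟨τ, hτ⟩) _ _ fun π => ?_
  rw [Equiv.coe_mulRight, Subgroup.coe_mul, map_mul, map_mul, smul_smul, mul_left_comm,
    sgn_mul_self, mul_one, Module.End.mul_apply]

theorem act_columnSum {lam : Ptn n} (t : Tableau lam)
    (ρ : Representation ℂ (Equiv.Perm (Fin n)) V) {τ : Equiv.Perm (Fin n)} (hτ : τ ∈ colStab t)
    (v : V) : ρ τ (columnSum t ρ v) = sgn τ • columnSum t ρ v := by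
  classical
  rw [columnSum_apply, Finset.smul_sum, map_sum]
  refine Fintype.sum_equiv (Equiv.mulLeft ⟨τ, hτ⟩) _ _ fun π => ?_
  rw [Equiv.coe_mulLeft, Subgroup.coe_mul, map_mul, map_mul, smul_smul, ← mul_assoc,
    sgn_mul_self, one_mul, map_smul, Module.End.mul_apply]

theorem polytabloid_act {lam : Ptn n} (t : Tableau lam) {τ : Equiv.Perm (Fin n)}
    (hτ : τ ∈ colStab t) : polytabloid (t.act τ) = sgn τ • polytabloid t := by
  rw [← tabloidModule_polytabloid, ← columnSum_single, act_columnSum t _ hτ]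

/-- The form is invariant, and $\pi\mapsto\pi^{-1}$ permutes the column stabilizer and preserves
signs. -/
theorem dot_columnSum {lam μ : Ptn n} (t : Tableau lam) (u v : MonoidAlgebra ℂ (Tabloid μ)) :
    dot μ (columnSum t (tabloidModule μ) u) v = dot μ u (columnSum t (tabloidModule μ) v) := by
  classical
  rw [columnSum_apply, columnSum_apply, map_sum, map_sum, LinearMap.sum_apply]
  refine Fintype.sum_equiv (Equiv.inv _) _ _ fun π => ?_
  rw [map_smul, map_smul, LinearMap.smul_apply, dot_act_left, Equiv.inv_apply, Subgroup.coe_inv,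
    sgn_inv]

/-! ### Dominance -/

/-- The number of boxes in the first `j` rows. -/
def boxesAbove (μ : Ptn n) (j : ℕ) : ℕ := (μ.1.cells.filter fun c => c.1 < j).card

theorem card_row_lt {μ : Ptn n} (s : Tableau μ) (j : ℕ) :
    (Finset.univ.filter fun x => s.row x < j).card = boxesAbove μ j := by
  refine Finset.card_bij (fun x _ => (s x).1) ?_ ?_ ?_
  · intro x hx
    exact Finset.mem_filter.2 ⟨(s x).2, (Finset.mem_filter.1 hx).2⟩
  · intro x _ y _ h
    exact s.injective (Subtype.ext h)
  · intro c hc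
    obtain ⟨hc, hj⟩ := Finset.mem_filter.1 hc
    refine ⟨s.symm ⟨c, hc⟩, Finset.mem_filter.2 ⟨Finset.mem_univ _, ?_⟩, by simp⟩
    simpa [Tableau.row] using hj

theorem card_col_row_lt {μ : Ptn n} (t : Tableau μ) (c j : ℕ) :
    (Finset.univ.filter fun x => t.col x = c ∧ t.row x < j).card = min j (μ.1.colLen c) := by
  rw [← Finset.card_range (min j _)]
  refine Finset.card_bij (fun x _ => t.row x) ?_ ?_ ?_
  · intro x hx
    obtain ⟨-, rfl, hj⟩ := Finset.mem_filter.1 hx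
    rw [Finset.mem_range, lt_min_iff]
    exact ⟨hj, YoungDiagram.mem_iff_lt_colLen.1 (t x).2⟩
  · intro x hx y hy h
    exact tableau_ext t h ((Finset.mem_filter.1 hx).2.1.trans (Finset.mem_filter.1 hy).2.1.symm)
  · intro i hi
    rw [Finset.mem_range, lt_min_iff] at hi
    have hc : (i, c) ∈ μ.1.cells := YoungDiagram.mem_iff_lt_colLen.2 hi.2
    refine ⟨t.symm ⟨(i, c), hc⟩, Finset.mem_filter.2 ⟨Finset.mem_univ _, ?_⟩, ?_⟩ <;>
      simp [Tableau.row, Tableau.col, hi.1]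

theorem row_lt_colLen {μ : Ptn n} (t : Tableau μ) (x : Fin n) :
    t.row x < μ.1.colLen (t.col x) :=
  YoungDiagram.mem_iff_lt_colLen.1 (t x).2

theorem card_col {μ : Ptn n} (t : Tableau μ) (c : ℕ) :
    (Finset.univ.filter fun x => t.col x = c).card = μ.1.colLen c := by
  rw [← min_self (μ.1.colLen c), ← card_col_row_lt t]
  congr 1
  refine Finset.filter_congr fun x _ => ⟨fun h => ⟨h, h ▸ row_lt_colLen t x⟩, fun h => h.1⟩

/-! ### Tableaux whose rows separate the columns of another tableau -/

section Separated

variable {lam μ : Ptn n} (t : Tableau lam) (s : Tableau μ)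

/-- Entries in the same column of `t` are in different rows of `s`. -/
def Separated : Prop := ∀ x y, t.col x = t.col y → s.row x = s.row y → x = y

variable {t s}

/-- Separation allows at most one entry of a column of `t` in each of the first $j$ rows of `s`. The
right side is the minimum of $j$ and the column length. -/
theorem Separated.card_le (h : Separated t s) (c j : ℕ) :
    (Finset.univ.filter fun x => t.col x = c ∧ s.row x < j).card ≤
      (Finset.univ.filter fun x => t.col x = c ∧ t.row x < j).card := by
  rw [card_col_row_lt, le_min_iff]
  constructor
  · refine (Finset.card_le_card_of_injOn (t := Finset.range j) s.row ?_ ?_).trans_eq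
      (Finset.card_range j)
    · intro x hx
      exact Finset.mem_coe.2 (Finset.mem_range.2 (Finset.mem_filter.1 (Finset.mem_coe.1 hx)).2.2)
    · intro x hx y hy hxy
      exact h x y ((Finset.mem_filter.1 (Finset.mem_coe.1 hx)).2.1.trans
        (Finset.mem_filter.1 (Finset.mem_coe.1 hy)).2.1.symm) hxy
  · rw [← card_col t c]
    exact Finset.card_le_card fun x hx => by
      simp only [Finset.mem_filter] at hx ⊢
      exact ⟨hx.1, hx.2.1⟩

theorem card_eq_sum_col (t : Tableau lam) (p : Fin n → Prop) [DecidablePred p] :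
    (Finset.univ.filter p).card = ∑ c ∈ Finset.univ.image t.col,
      (Finset.univ.filter fun x => t.col x = c ∧ p x).card := by
  rw [Finset.card_eq_sum_card_fiberwise (f := t.col) (t := Finset.univ.image t.col)
    fun x _ => by simp]
  refine Finset.sum_congr rfl fun c _ => ?_
  rw [Finset.filter_filter]
  simp only [and_comm]

theorem Separated.boxesAbove_le (h : Separated t s) (j : ℕ) :
    boxesAbove μ j ≤ boxesAbove lam j := by
  rw [← card_row_lt s, ← card_row_lt t, card_eq_sum_col t, card_eq_sum_col t]
  exact Finset.sum_le_sum fun c _ => h.card_le c j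

/-- For equal shapes the columnwise inequalities sum to an equality, so each is an equality. With
$j$ the length of the column of $x$ in `t`, that whole column lies in the first $j$ rows of `s`. -/
theorem Separated.row_lt_colLen {s : Tableau lam} (h : Separated t s) (x : Fin n) :
    s.row x < lam.1.colLen (t.col x) := by
  set j := lam.1.colLen (t.col x)
  have h₁ := (card_row_lt s j).trans (card_row_lt t j).symm
  rw [card_eq_sum_col t, card_eq_sum_col t,
    Finset.sum_eq_sum_iff_of_le fun c _ => h.card_le c j] at h₁
  have h₂ := h₁ (t.col x) (Finset.mem_image_of_mem _ (Finset.mem_univ x))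
  rw [card_col_row_lt, min_self] at h₂
  replace h₂ := h₂.trans (card_col t (t.col x)).symm
  have h₃ := Finset.eq_of_subset_of_card_le (fun y hy => by
    simp only [Finset.mem_filter] at hy ⊢
    exact ⟨hy.1, hy.2.1⟩) h₂.ge
  have : x ∈ Finset.univ.filter fun y => t.col y = t.col x := by simp
  rw [← h₃] at this
  exact (Finset.mem_filter.1 this).2.2

theorem Separated.exists_colStab {s : Tableau lam} (h : Separated t s) :
    ∃ π ∈ colStab t, Tabloid.mk s = Tabloid.mk (t.act π) := by
  -- Taking rows from `s` and columns from `t` gives a tableau that is row equivalent to `s` and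
  -- column equivalent to `t`.
  let f : Fin n → {c : ℕ × ℕ // c ∈ lam.1.cells} := fun x =>
    ⟨(s.row x, t.col x), YoungDiagram.mem_iff_lt_colLen.2 (h.row_lt_colLen x)⟩
  have hf : Function.Bijective f := by
    rw [Fintype.bijective_iff_injective_and_card, card_cells, Fintype.card_fin]
    refine ⟨fun x y hxy => ?_, rfl⟩
    have h₁ : (s.row x, t.col x) = (s.row y, t.col y) := congrArg Subtype.val hxy
    exact h x y (Prod.mk.inj h₁).2 (Prod.mk.inj h₁).1
  let t' : Tableau lam := Equiv.ofBijective f hf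
  have ht' : t.act (t.trans t'.symm) = t' := Equiv.ext fun x => by simp [Tableau.act]
  refine ⟨t.trans t'.symm, fun x => ?_, ?_⟩
  · change t'.col (t'.symm (t x)) = _
    rw [Tableau.col, Equiv.apply_symm_apply]
    rfl
  · rw [ht']
    exact Quotient.sound fun x => rfl

/-- Two entries in one column of `t` and one row of `s` give a transposition in the column
stabilizer that fixes the tabloid of `s`. The column sum then equals its own negative. -/
theorem columnSum_single_eq_zero (h : ¬ Separated t s) :
    columnSum t (tabloidModule μ) (MonoidAlgebra.single (Tabloid.mk s) 1) = 0 := by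
  classical
  simp only [Separated, not_forall] at h
  obtain ⟨x, y, hc, hr, hxy⟩ := h
  have hmem : Equiv.swap x y ∈ colStab t := by
    intro z
    rcases eq_or_ne z x with rfl | hx
    · rw [Equiv.swap_apply_left, hc]
    rcases eq_or_ne z y with rfl | hy
    · rw [Equiv.swap_apply_right, hc]
    · rw [Equiv.swap_apply_of_ne_of_ne hx hy]
  have hfix : Tabloid.mk (s.act (Equiv.swap x y)) = Tabloid.mk s := by
    refine Quotient.sound fun z => ?_
    change s.row ((Equiv.swap x y).symm z) = _
    rw [Equiv.symm_swap]
    rcases eq_or_ne z x with rfl | hx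
    · rw [Equiv.swap_apply_left, hr]
    rcases eq_or_ne z y with rfl | hy
    · rw [Equiv.swap_apply_right, hr]
    · rw [Equiv.swap_apply_of_ne_of_ne hx hy]
  have := columnSum_act t (tabloidModule μ) hmem (MonoidAlgebra.single (Tabloid.mk s) 1)
  rw [Representation.ofMulAction_single, smul_mk, hfix, sgn_apply, Equiv.Perm.sign_swap hxy] at this
  rw [Units.val_neg, Units.val_one, Int.cast_neg, Int.cast_one, neg_one_smul] at this
  refine (smul_eq_zero.1 ?_).resolve_left (two_ne_zero (α := ℂ))
  rw [two_smul]
  exact add_eq_zero_iff_eq_neg.2 this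

/-- A separated `s` would force `lam` to dominate `μ`, so every tabloid is killed. This makes
Peter–Weyl triangular. -/
theorem columnSum_eq_zero (t : Tableau lam) {j : ℕ} (h : boxesAbove lam j < boxesAbove μ j) :
    columnSum t (tabloidModule μ) = 0 := by
  refine MonoidAlgebra.lhom_ext' fun T => LinearMap.ext_ring ?_
  induction T using Tabloid.ind with
  | h s => exact columnSum_single_eq_zero fun hs => (hs.boxesAbove_le j).not_gt h

end Separated

/-- Consecutive differences are the row lengths. Hence dominance is antisymmetric. -/
theorem boxesAbove_injective : Function.Injective (boxesAbove : Ptn n → ℕ → ℕ) := by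
  intro lam μ h
  have hrow (ν : Ptn n) (i : ℕ) : boxesAbove ν (i + 1) = boxesAbove ν i + ν.1.rowLen i := by
    rw [boxesAbove, boxesAbove, YoungDiagram.rowLen_eq_card, ← Finset.card_union_of_disjoint]
    · congr 1
      ext c
      simp only [Finset.mem_filter, Finset.mem_union, YoungDiagram.mem_row_iff,
        YoungDiagram.mem_cells, Nat.lt_succ_iff_lt_or_eq]
      tauto
    · rw [Finset.disjoint_left]
      intro c hc hc'
      rw [YoungDiagram.mem_row_iff] at hc'
      exact absurd (Finset.mem_filter.1 hc).2 (by omega)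
  have hlen (i : ℕ) : lam.1.rowLen i = μ.1.rowLen i := by
    have h₁ := hrow lam i
    rw [h, hrow μ i] at h₁
    omega
  refine Subtype.ext (YoungDiagram.ext (Finset.ext fun ⟨i, j⟩ => ?_))
  rw [YoungDiagram.mem_cells, YoungDiagram.mem_cells, YoungDiagram.mem_iff_lt_rowLen,
    YoungDiagram.mem_iff_lt_rowLen, hlen]

theorem coeff_polytabloid_self {lam : Ptn n} (t : Tableau lam) :
    (polytabloid t).coeff (Tabloid.mk t) = 1 := by
  classical
  rw [← dot_single, polytabloid, map_sum, Finset.sum_eq_single 1]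
  · rw [map_smul, dot_single, OneMemClass.coe_one, map_one, Units.val_one, Int.cast_one, one_smul]
    simp [Tableau.act, Equiv.Perm.one_def]
  · intro π _ hπ
    rw [map_smul, dot_single, MonoidAlgebra.coeff_single, Finsupp.single_apply, if_neg, smul_zero]
    intro h
    refine hπ (Subtype.ext (Equiv.ext fun x => ?_))
    have h₁ := Quotient.exact h (π.1 x)
    change t.row (π.1.symm (π.1 x)) = _ at h₁
    rw [Equiv.symm_apply_apply] at h₁
    exact tableau_ext t h₁.symm (π.2 x)
  · simp

/-- On `M^lam`, the signed column sum of a `lam`-tableau has rank one. -/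
theorem columnSum_eq {lam : Ptn n} (t : Tableau lam) (m : MonoidAlgebra ℂ (Tabloid lam)) :
    columnSum t (tabloidModule lam) m = dot lam m (polytabloid t) • polytabloid t := by
  have h : columnSum t (tabloidModule lam) m ∈ Submodule.span ℂ {polytabloid t} := by
    refine (Submodule.Quotient.mk_eq_zero _).1 ?_
    refine LinearMap.congr_fun (f := Submodule.mkQ _ ∘ₗ columnSum t (tabloidModule lam)) (g := 0)
      (MonoidAlgebra.lhom_ext' fun T => LinearMap.ext_ring ?_) m
    refine (Submodule.Quotient.mk_eq_zero _).2 ?_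
    induction T using Tabloid.ind with
    | h s =>
      rw [MonoidAlgebra.lsingle_apply]
      by_cases hs : Separated t s
      · obtain ⟨π, hπ, h⟩ := hs.exists_colStab
        rw [h, ← smul_mk, ← Representation.ofMulAction_single, columnSum_act t _ hπ,
          columnSum_single]
        exact Submodule.smul_mem _ _ (Submodule.mem_span_singleton_self _)
      · rw [columnSum_single_eq_zero hs]
        exact Submodule.zero_mem _
  obtain ⟨c, hc⟩ := Submodule.mem_span_singleton.1 h
  rw [← hc]
  congr 1
  -- The scalar is read off at the tabloid of `t`, where the polytabloid has coefficient 1;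
  -- self-adjointness moves the column sum onto that tabloid.
  rw [dot_comm, ← columnSum_single, dot_columnSum, ← hc, dot_single, MonoidAlgebra.coeff_smul,
    Finsupp.smul_apply, coeff_polytabloid_self, smul_eq_mul, mul_one]

end GenFoulkes

namespace GenFoulkes

variable {n : ℕ}

/-! ### Nondegeneracy and irreducibility -/

theorem conj_coeff_polytabloid {lam : Ptn n} (t : Tableau lam) (T : Tabloid lam) :
    (starRingEnd ℂ) ((polytabloid t).coeff T) = (polytabloid t).coeff T := by
  classical
  rw [← dot_single, polytabloid, map_sum, map_sum]
  refine Finset.sum_congr rfl fun π _ => ?_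
  rw [map_smul, dot_single, MonoidAlgebra.coeff_single, Finsupp.single_apply, smul_eq_mul, map_mul,
    map_intCast]
  split_ifs <;> simp

theorem eq_zero_of_sum_mul_conj {lam : Ptn n} {v : MonoidAlgebra ℂ (Tabloid lam)}
    (h : ∑ T, v.coeff T * (starRingEnd ℂ) (v.coeff T) = 0) : v = 0 := by
  have h₁ : ∑ T, Complex.normSq (v.coeff T) = 0 := by
    have : ((∑ T, Complex.normSq (v.coeff T) : ℝ) : ℂ) = 0 := by
      rw [← h, Complex.ofReal_sum]
      exact Finset.sum_congr rfl fun T _ => (Complex.mul_conj _).symm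
    exact_mod_cast this
  rw [Finset.sum_eq_zero_iff_of_nonneg fun T _ => Complex.normSq_nonneg _] at h₁
  refine MonoidAlgebra.ext (Finsupp.ext fun T => ?_)
  exact Complex.normSq_eq_zero.1 (h₁ T (Finset.mem_univ T))

/-- Polytabloids have real coefficients, so `v` is also orthogonal to their span for the Hermitian
form. That span contains `v`, and the form is definite. -/
theorem eq_zero_of_dot {lam : Ptn n} {v : MonoidAlgebra ℂ (Tabloid lam)}
    (hv : v ∈ (spechtSub lam).toSubmodule) (h : ∀ t, dot lam v (polytabloid t) = 0) : v = 0 := by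
  refine eq_zero_of_sum_mul_conj ?_
  have h₁ : ∀ w ∈ (spechtSub lam).toSubmodule,
      ∑ T, v.coeff T * (starRingEnd ℂ) (w.coeff T) = 0 := by
    intro w hw
    refine Submodule.span_induction ?_ (by simp) (fun w w' _ _ h h' => ?_) (fun c w _ h => ?_) hw
    · rintro _ ⟨t, rfl⟩
      simp only [conj_coeff_polytabloid]
      exact h t
    · simp [mul_add, Finset.sum_add_distrib, h, h']
    · simp [mul_left_comm, ← Finset.mul_sum, h]
  exact h₁ v hv

theorem polytabloid_ne_zero {lam : Ptn n} (t : Tableau lam) : polytabloid t ≠ 0 := by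
  intro h
  have := coeff_polytabloid_self t
  rw [h] at this
  simp at this

theorem dot_polytabloid_self_ne_zero {lam : Ptn n} (t : Tableau lam) :
    dot lam (polytabloid t) (polytabloid t) ≠ 0 := by
  intro h
  refine polytabloid_ne_zero t (eq_zero_of_sum_mul_conj ?_)
  simp only [conj_coeff_polytabloid]
  exact h

theorem polytabloid_mem {lam : Ptn n} (t : Tableau lam) :
    polytabloid t ∈ (spechtSub lam).toSubmodule :=
  Submodule.subset_span ⟨t, rfl⟩

/-- Specht modules are irreducible. -/
theorem eq_specht_of_le {lam : Ptn n} (N : Submodule ℂ (MonoidAlgebra ℂ (Tabloid lam)))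
    (hN : ∀ σ, ∀ v ∈ N, tabloidModule lam σ v ∈ N) (hle : N ≤ (spechtSub lam).toSubmodule)
    (hbot : N ≠ ⊥) : N = (spechtSub lam).toSubmodule := by
  classical
  refine le_antisymm hle (Submodule.span_le.2 ?_)
  obtain ⟨v, hv, hv₀⟩ := Submodule.exists_mem_ne_zero_of_ne_bot hbot
  obtain ⟨t, ht⟩ : ∃ t, dot lam v (polytabloid t) ≠ 0 := by
    by_contra! h
    exact hv₀ (eq_zero_of_dot (hle hv) h)
  have ht' : polytabloid t ∈ N := by
    -- James's submodule argument: the column sum of $v\in N$ stays in $N$ and is a nonzero multiple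
    -- of $e_t$.
    rw [← N.smul_mem_iff ht, ← columnSum_eq, columnSum_apply]
    exact Submodule.sum_mem _ fun π _ => N.smul_mem _ (hN _ _ hv)
  rintro _ ⟨s, rfl⟩
  obtain ⟨σ, rfl⟩ := exists_act_eq t s
  change polytabloid (t.act σ) ∈ N
  rw [← tabloidModule_polytabloid]
  exact hN _ _ ht'

/-! ### The sign twist -/

/-- The transposed tableau. -/
def Tableau.transpose {lam : Ptn n} (t : Tableau lam.conj) : Tableau lam :=
  t.trans ((Equiv.prodComm ℕ ℕ).subtypeEquiv fun c => by
    rw [YoungDiagram.mem_cells, YoungDiagram.mem_cells]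
    exact YoungDiagram.mem_transpose)

theorem Tableau.transpose_act {lam : Ptn n} (t : Tableau lam.conj) (σ : Equiv.Perm (Fin n)) :
    (t.act σ).transpose = t.transpose.act σ := rfl

/-- A reference tableau. -/
def refTableau (lam : Ptn n) : Tableau lam := Classical.arbitrary _

/-- The sign of the permutation that sends the reference tableau to `t`. -/
def tableauSign {lam : Ptn n} (t : Tableau lam) : ℂ :=
  sgn ((refTableau lam).trans t.symm : Equiv.Perm (Fin n))

theorem tableauSign_act {lam : Ptn n} (t : Tableau lam) (σ : Equiv.Perm (Fin n)) :
    tableauSign (t.act σ) = sgn σ * tableauSign t := by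
  rw [tableauSign, tableauSign, ← map_mul]
  rfl

theorem tableauSign_ne_zero {lam : Ptn n} (t : Tableau lam) : tableauSign t ≠ 0 :=
  left_ne_zero_of_mul_eq_one (sgn_mul_self _)

/-- The signed polytabloid of the transposed tableau depends only on the tabloid. -/
def signedTranspose (lam : Ptn n) (T : Tabloid lam.conj) : MonoidAlgebra ℂ (Tabloid lam) :=
  Quotient.lift (fun t : Tableau lam.conj => tableauSign t • polytabloid t.transpose) (by
    intro t s h
    obtain ⟨π, rfl⟩ := exists_act_eq t s
    -- Row equivalence becomes a column permutation after transposing. Its sign on the polytabloid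
    -- cancels its effect on `tableauSign`.
    have hπ : π ∈ colStab t.transpose := by
      intro x
      have := h (π x)
      change t.row (π x) = t.row (π.symm (π x)) at this
      rwa [Equiv.symm_apply_apply] at this
    rw [tableauSign_act, Tableau.transpose_act, polytabloid_act _ hπ, smul_smul, mul_right_comm,
      sgn_mul_self, one_mul]) T

theorem signedTranspose_mk {lam : Ptn n} (t : Tableau lam.conj) :
    signedTranspose lam (Tabloid.mk t) = tableauSign t • polytabloid t.transpose := rfl

/-- The map `M^{lam'} → M^lam` that sends a tabloid to the signed polytabloid of the transposed
tableau. -/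
def twistTabloid (lam : Ptn n) :
    MonoidAlgebra ℂ (Tabloid lam.conj) →ₗ[ℂ] MonoidAlgebra ℂ (Tabloid lam) :=
  Finsupp.linearCombination ℂ (signedTranspose lam) ∘ₗ
    (MonoidAlgebra.coeffLinearEquiv ℂ).toLinearMap

theorem twistTabloid_single {lam : Ptn n} (t : Tableau lam.conj) :
    twistTabloid lam (MonoidAlgebra.single (Tabloid.mk t) 1) =
      tableauSign t • polytabloid t.transpose := by
  rw [← signedTranspose_mk]
  simp [twistTabloid]

theorem twistTabloid_act (lam : Ptn n) (σ : Equiv.Perm (Fin n))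
    (v : MonoidAlgebra ℂ (Tabloid lam.conj)) :
    twistTabloid lam (tabloidModule lam.conj σ v) =
      sgn σ • tabloidModule lam σ (twistTabloid lam v) := by
  refine LinearMap.congr_fun (f := twistTabloid lam ∘ₗ tabloidModule lam.conj σ)
    (g := sgn σ • tabloidModule lam σ ∘ₗ twistTabloid lam)
    (MonoidAlgebra.lhom_ext' fun T => LinearMap.ext_ring ?_) v
  induction T using Tabloid.ind with
  | h t =>
    simp only [LinearMap.comp_apply, LinearMap.smul_apply, MonoidAlgebra.lsingle_apply]
    rw [Representation.ofMulAction_single, smul_mk, twistTabloid_single, twistTabloid_single,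
      tableauSign_act, Tableau.transpose_act, map_smul, tabloidModule_polytabloid, smul_smul]

theorem twistTabloid_mem (lam : Ptn n) (v : MonoidAlgebra ℂ (Tabloid lam.conj)) :
    twistTabloid lam v ∈ (spechtSub lam).toSubmodule := by
  refine (Submodule.Quotient.mk_eq_zero _).1 ?_
  refine LinearMap.congr_fun (f := Submodule.mkQ _ ∘ₗ twistTabloid lam) (g := 0)
    (MonoidAlgebra.lhom_ext' fun T => LinearMap.ext_ring ?_) v
  refine (Submodule.Quotient.mk_eq_zero _).2 ?_
  induction T using Tabloid.ind with
  | h t =>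
    rw [MonoidAlgebra.lsingle_apply, twistTabloid_single]
    exact Submodule.smul_mem _ _ (polytabloid_mem _)

/-- At the tabloid of the transposed tableau no cancellation occurs: each $\pi\in C_t$ fixes this
tabloid, and its sign in $e_t$ cancels the sign from the twist. Every term contributes `tableauSign
t`. -/
theorem twistTabloid_polytabloid_ne_zero {lam : Ptn n} (t : Tableau lam.conj) :
    twistTabloid lam (polytabloid t) ≠ 0 := by
  classical
  intro h
  have h₁ : dot lam (MonoidAlgebra.single (Tabloid.mk t.transpose) 1)
      (twistTabloid lam (polytabloid t)) = Fintype.card (colStab t) * tableauSign t := by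
    rw [← columnSum_single, columnSum_apply, map_sum, map_sum, ← nsmul_eq_mul, ← Finset.card_univ]
    refine Finset.sum_eq_card_nsmul fun π _ => ?_
    have h₂ : Tabloid.mk (t.transpose.act π.1⁻¹) = Tabloid.mk t.transpose :=
      Quotient.sound fun x => π.2 x
    rw [map_smul, twistTabloid_act, smul_smul, sgn_mul_self, one_smul, twistTabloid_single,
      map_smul, map_smul, dot_single, Representation.coeff_ofMulAction, smul_mk, h₂,
      coeff_polytabloid_self, smul_eq_mul, mul_one]
  rw [h, map_zero, eq_comm, mul_eq_zero] at h₁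
  exact h₁.elim (Nat.cast_ne_zero.2 Fintype.card_ne_zero) (tableauSign_ne_zero t)

/-- `S^{lam'}` is isomorphic to `S^lam`, up to the sign. -/
theorem exists_signTwist (lam : Ptn n) :
    ∃ θ : (spechtSub lam.conj).toSubmodule ≃ₗ[ℂ] (spechtSub lam).toSubmodule,
      ∀ σ u, θ (specht lam.conj σ u) = sgn σ • specht lam σ (θ u) := by
  obtain ⟨t⟩ : Nonempty (Tableau lam.conj) := inferInstance
  let θ : (spechtSub lam.conj).toSubmodule →ₗ[ℂ] (spechtSub lam).toSubmodule :=
    (twistTabloid lam ∘ₗ (spechtSub lam.conj).toSubmodule.subtype).codRestrict _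
      fun v => twistTabloid_mem lam v
  have hθ (v) : (θ v : MonoidAlgebra ℂ (Tabloid lam)) = twistTabloid lam v := rfl
  -- Schur's argument: kernel and image are invariant, so irreducibility makes the twist bijective
  -- once it is nonzero on a polytabloid.
  have hker : LinearMap.ker (twistTabloid lam) ⊓ (spechtSub lam.conj).toSubmodule = ⊥ := by
    by_contra hbot
    have := eq_specht_of_le _ (fun σ v hv => ?_) inf_le_right hbot
    · have h₁ := polytabloid_mem t
      rw [← this] at h₁
      exact twistTabloid_polytabloid_ne_zero t h₁.1
    · refine ⟨?_, (spechtSub lam.conj).apply_mem_toSubmodule σ hv.2⟩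
      have h₀ : twistTabloid lam v = 0 := hv.1
      rw [SetLike.mem_coe, LinearMap.mem_ker, twistTabloid_act, h₀, map_zero, smul_zero]
  have hrange : (spechtSub lam.conj).toSubmodule.map (twistTabloid lam) =
      (spechtSub lam).toSubmodule := by
    refine eq_specht_of_le _ (fun σ v hv => ?_) ?_ fun hbot => ?_
    · obtain ⟨u, hu, rfl⟩ := hv
      refine ⟨sgn σ • tabloidModule lam.conj σ u, Submodule.smul_mem _ _
        ((spechtSub lam.conj).apply_mem_toSubmodule σ hu), ?_⟩
      rw [map_smul, twistTabloid_act, smul_smul, sgn_mul_self, one_smul]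
    · rintro _ ⟨u, -, rfl⟩
      exact twistTabloid_mem lam u
    · have h₁ : twistTabloid lam (polytabloid t) ∈
          (spechtSub lam.conj).toSubmodule.map (twistTabloid lam) :=
        Submodule.mem_map_of_mem (polytabloid_mem t)
      rw [hbot] at h₁
      exact twistTabloid_polytabloid_ne_zero t h₁
  refine ⟨LinearEquiv.ofBijective θ ⟨?_, ?_⟩, fun σ u => Subtype.ext ?_⟩
  · rw [injective_iff_map_eq_zero]
    intro u hu
    have h₁ : u.1 ∈ LinearMap.ker (twistTabloid lam) ⊓ (spechtSub lam.conj).toSubmodule :=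
      ⟨congrArg Subtype.val hu, u.2⟩
    rw [hker] at h₁
    exact Subtype.ext h₁
  · rintro ⟨v, hv⟩
    rw [← hrange] at hv
    obtain ⟨u, hu, rfl⟩ := hv
    exact ⟨⟨u, hu⟩, rfl⟩
  · exact twistTabloid_act lam σ u

end GenFoulkes

namespace GenFoulkes

variable {n : ℕ}

/-! ### Counting partitions -/

instance : Finite (Ptn n) := by
  refine Finite.of_injective (β := ((Finset.range n ×ˢ Finset.range n).powerset))
    (fun μ => ⟨μ.1.cells, Finset.mem_powerset.2 fun c hc => ?_⟩) fun μ ν h =>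
      Subtype.ext (YoungDiagram.ext (congrArg Subtype.val h))
  have hc' : (c.1, c.2) ∈ μ.1 := hc
  have hμ := μ.2
  rw [Finset.mem_product, Finset.mem_range, Finset.mem_range]
  constructor
  · refine (YoungDiagram.mem_iff_lt_colLen.1 hc').trans_le ?_
    rw [YoungDiagram.colLen_eq_card]
    exact (Finset.card_le_card (Finset.filter_subset _ _)).trans_eq hμ
  · refine (YoungDiagram.mem_iff_lt_rowLen.1 hc').trans_le ?_
    rw [YoungDiagram.rowLen_eq_card]
    exact (Finset.card_le_card (Finset.filter_subset _ _)).trans_eq hμ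

instance : Fintype (Ptn n) := Fintype.ofFinite _

theorem card_cellsOfRowLens (w : List ℕ) : (YoungDiagram.cellsOfRowLens w).card = w.sum := by
  induction w with
  | nil => rfl
  | cons a w ih =>
    rw [YoungDiagram.cellsOfRowLens, Finset.card_union_of_disjoint, Finset.card_map, ih,
      Finset.card_product, Finset.card_singleton, one_mul, Finset.card_range, List.sum_cons]
    rw [Finset.disjoint_left]
    rintro ⟨i, j⟩ h h'
    simp only [Finset.mem_product, Finset.mem_singleton] at h
    simp [h.1] at h'

/-- The Young diagram of a partition. -/
def ofPartition (p : n.Partition) : Ptn n :=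
  ⟨YoungDiagram.ofRowLens (p.parts.sort (· ≥ ·)) (Multiset.pairwise_sort _ _).sortedGE, by
    refine (card_cellsOfRowLens _).trans ?_
    rw [← Multiset.sum_coe, Multiset.sort_eq, p.parts_sum]⟩

theorem ofPartition_injective : Function.Injective (ofPartition : n.Partition → Ptn n) := by
  intro p q h
  have hp (p : n.Partition) : (ofPartition p).1.rowLens = p.parts.sort (· ≥ ·) :=
    YoungDiagram.rowLens_ofRowLens_eq_self (hw := (Multiset.pairwise_sort _ _).sortedGE)
      fun x hx => p.parts_pos ((Multiset.mem_sort _).1 hx)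
  have h₁ := (hp p).symm.trans ((congrArg (fun μ : Ptn n => μ.1.rowLens) h).trans (hp q))
  refine Nat.Partition.ext ?_
  rw [← Multiset.sort_eq p.parts (· ≥ ·), h₁, Multiset.sort_eq]

/-- Cycle types separate conjugacy classes. Only this inequality is needed, as independence of the
class functions gives the other one. -/
theorem card_conjClasses_le [Fintype (ConjClasses (Equiv.Perm (Fin n)))] :
    Fintype.card (ConjClasses (Equiv.Perm (Fin n))) ≤ Fintype.card (Ptn n) := by
  let f : ConjClasses (Equiv.Perm (Fin n)) → (Fintype.card (Fin n)).Partition :=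
    Quotient.lift Equiv.Perm.partition fun σ τ h => Equiv.Perm.partition_eq_of_isConj.1 h
  have hf : Function.Injective f := by
    rintro ⟨σ⟩ ⟨τ⟩ h
    exact Quotient.sound (Equiv.Perm.partition_eq_of_isConj.2 h)
  refine (Fintype.card_le_of_injective _ (ofPartition_injective.comp hf)).trans_eq ?_
  rw [Fintype.card_fin]

/-! ### Matrix coefficients of Specht modules -/

/-- The matrix coefficients of `S^lam`. -/
def matCoeff (lam : Ptn n) : (spechtSub lam).toSubmodule ⊗[ℂ] (spechtSub lam).toSubmodule →ₗ[ℂ]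
    (Equiv.Perm (Fin n) → ℂ) :=
  TensorProduct.lift (LinearMap.mk₂ ℂ
    (fun u v g => dot lam u (tabloidModule lam g v))
    (fun u u' v => funext fun g => by simp)
    (fun c u v => funext fun g => by simp)
    (fun u v v' => funext fun g => by simp)
    (fun c u v => funext fun g => by simp))

theorem matCoeff_tmul (lam : Ptn n) (u v : (spechtSub lam).toSubmodule)
    (g : Equiv.Perm (Fin n)) :
    matCoeff lam (u ⊗ₜ v) g = dot lam u (tabloidModule lam g v) := rfl

open scoped Classical in
/-- The signed sum over a translate of a column stabilizer, as a functional. -/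
def columnEval {lam : Ptn n} (t : Tableau lam) (g : Equiv.Perm (Fin n)) :
    (Equiv.Perm (Fin n) → ℂ) →ₗ[ℂ] ℂ :=
  ∑ π : colStab t, sgn π.1 • LinearMap.proj (g * π.1)

theorem columnEval_matCoeff {lam μ : Ptn n} (t : Tableau lam) (g : Equiv.Perm (Fin n))
    (u v : (spechtSub μ).toSubmodule) :
    columnEval t g (matCoeff μ (u ⊗ₜ v)) =
      dot μ u (tabloidModule μ g (columnSum t (tabloidModule μ) v)) := by
  classical
  rw [columnEval, columnSum_apply, LinearMap.sum_apply, map_sum, map_sum]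
  refine Fintype.sum_equiv (Equiv.refl _) _ _ fun π => ?_
  rw [LinearMap.smul_apply, LinearMap.proj_apply, matCoeff_tmul, map_mul, Module.End.mul_apply,
    Equiv.refl_apply, map_smul, map_smul]

theorem columnEval_matCoeff_eq_zero {lam μ : Ptn n} (t : Tableau lam) (g : Equiv.Perm (Fin n))
    {j : ℕ} (h : boxesAbove lam j < boxesAbove μ j)
    (x : (spechtSub μ).toSubmodule ⊗[ℂ] (spechtSub μ).toSubmodule) :
    columnEval t g (matCoeff μ x) = 0 := by
  refine LinearMap.congr_fun (f := columnEval t g ∘ₗ matCoeff μ) (g := 0)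
    (TensorProduct.ext' fun u v => ?_) x
  rw [LinearMap.comp_apply, columnEval_matCoeff, columnSum_eq_zero t h, LinearMap.zero_apply,
    map_zero, map_zero, LinearMap.zero_apply]

/-- The dot products with the polytabloids. -/
def polyCoords (lam : Ptn n) : (spechtSub lam).toSubmodule →ₗ[ℂ] (Tableau lam → ℂ) :=
  LinearMap.pi fun t => (dot lam).flip (polytabloid t) ∘ₗ (spechtSub lam).toSubmodule.subtype

theorem polyCoords_apply (lam : Ptn n) (v : (spechtSub lam).toSubmodule) (t : Tableau lam) :
    polyCoords lam v t = dot lam v (polytabloid t) := rfl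

theorem polyCoords_injective (lam : Ptn n) : Function.Injective (polyCoords lam) := by
  rw [injective_iff_map_eq_zero]
  exact fun v hv => Subtype.ext (eq_zero_of_dot v.2 fun t => congrFun hv t)

/-- On $u\otimes v$ the functional is $\langle v,e_t\rangle\langle u,e_{gt}\rangle$, by the rank-one
formula. As $t$ and $g$ vary these are all coordinates of `x` under the square of the injective map
`polyCoords`. -/
theorem eq_zero_of_columnEval {lam : Ptn n}
    {x : (spechtSub lam).toSubmodule ⊗[ℂ] (spechtSub lam).toSubmodule}
    (h : ∀ (t : Tableau lam) g, columnEval t g (matCoeff lam x) = 0) : x = 0 := by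
  classical
  refine TensorProduct.map_injective_of_flat_flat _ _ (polyCoords_injective lam)
    (polyCoords_injective lam) ?_
  refine (TensorProduct.piScalarRight ℂ ℂ (Tableau lam → ℂ) (Tableau lam)).injective ?_
  rw [map_zero, map_zero]
  funext t s
  obtain ⟨g, rfl⟩ := exists_act_eq t s
  rw [Pi.zero_apply, Pi.zero_apply, ← h t g]
  refine LinearMap.congr_fun (f := LinearMap.proj (t.act g) ∘ₗ LinearMap.proj t ∘ₗ
      (TensorProduct.piScalarRight ℂ ℂ (Tableau lam → ℂ) (Tableau lam)).toLinearMap ∘ₗ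
        TensorProduct.map (polyCoords lam) (polyCoords lam))
    (g := columnEval t g ∘ₗ matCoeff lam) (TensorProduct.ext' fun u v => ?_) x
  simp only [LinearMap.comp_apply, TensorProduct.map_tmul, LinearEquiv.coe_coe,
    columnEval_matCoeff, columnSum_eq, map_smul, tabloidModule_polytabloid]
  simp [polyCoords_apply]

/-- The matrix coefficients of all Specht modules. -/
def peterWeyl (n : ℕ) :
    (⨁ lam : Ptn n, (spechtSub lam).toSubmodule ⊗[ℂ] (spechtSub lam).toSubmodule) →ₗ[ℂ]
      (Equiv.Perm (Fin n) → ℂ) :=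
  ∑ lam : Ptn n, matCoeff lam ∘ₗ DirectSum.component ℂ (Ptn n)
    (fun lam => (spechtSub lam).toSubmodule ⊗[ℂ] (spechtSub lam).toSubmodule) lam

theorem peterWeyl_apply
    (x : ⨁ lam : Ptn n, (spechtSub lam).toSubmodule ⊗[ℂ] (spechtSub lam).toSubmodule) :
    peterWeyl n x = ∑ lam : Ptn n, matCoeff lam (x lam) := by
  rw [peterWeyl, LinearMap.sum_apply]
  rfl

theorem peterWeyl_lof [DecidableEq (Ptn n)] (lam : Ptn n)
    (x : (spechtSub lam).toSubmodule ⊗[ℂ] (spechtSub lam).toSubmodule) :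
    peterWeyl n (DirectSum.lof ℂ (Ptn n)
      (fun lam => (spechtSub lam).toSubmodule ⊗[ℂ] (spechtSub lam).toSubmodule) lam x) =
      matCoeff lam x := by
  rw [peterWeyl_apply, Finset.sum_eq_single lam]
  · rw [DirectSum.lof_apply]
  · intro μ _ hμ
    rw [DirectSum.lof_eq_of, DirectSum.of_eq_of_ne _ _ _ hμ, map_zero]
  · simp

theorem peterWeyl_injective (n : ℕ) : Function.Injective (peterWeyl n) := by
  classical
  let _ : AddCommGroup (⨁ lam : Ptn n,
      (spechtSub lam).toSubmodule ⊗[ℂ] (spechtSub lam).toSubmodule) :=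
    Module.addCommMonoidToAddCommGroup ℂ
  rw [injective_iff_map_eq_zero]
  intro x hx
  by_contra hx₀
  obtain ⟨lam₀, h₀⟩ : ∃ lam, x lam ≠ 0 := by
    by_contra! h
    exact hx₀ (DFinsupp.ext fun lam => by rw [h]; rfl)
  -- For a dominance-minimal shape in the support, every other shape in the support is not dominated
  -- by it, so column sums of shape `lam` isolate the component at `lam`.
  obtain ⟨lam, hlam⟩ := (Finset.univ.filter fun lam => x lam ≠ 0).exists_minimalFor boxesAbove
    ⟨lam₀, by simpa using h₀⟩
  refine (Finset.mem_filter.1 hlam.1).2 (eq_zero_of_columnEval fun t g => ?_)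
  have h₁ := congrArg (columnEval t g) hx
  rw [peterWeyl_apply, map_sum, map_zero, Finset.sum_eq_single lam] at h₁
  · exact h₁
  · intro μ _ hμ
    by_cases hxμ : x μ = 0
    · rw [hxμ, map_zero, map_zero]
    · obtain ⟨j, hj⟩ : ∃ j, boxesAbove lam j < boxesAbove μ j := by
        by_contra! hle
        refine hμ (boxesAbove_injective (le_antisymm hle (hlam.2 ?_ hle)))
        simpa using hxμ
      exact columnEval_matCoeff_eq_zero t g hj _
  · simp

theorem matCoeff_equivariant (lam : Ptn n) (h k g : Equiv.Perm (Fin n))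
    (u v : (spechtSub lam).toSubmodule) :
    matCoeff lam (specht lam h u ⊗ₜ specht lam k v) g = matCoeff lam (u ⊗ₜ v) (h⁻¹ * g * k) := by
  rw [matCoeff_tmul, matCoeff_tmul, map_mul, map_mul]
  change dot lam (tabloidModule lam h u) (tabloidModule lam g (tabloidModule lam k v)) = _
  rw [dot_act_left]
  rfl

theorem peterWeyl_equivariant (h k : Equiv.Perm (Fin n)) (q) (g : Equiv.Perm (Fin n)) :
    peterWeyl n (Representation.sumExt (fun lam => specht lam) (fun lam => specht lam) (h, k) q) g =
      peterWeyl n q (h⁻¹ * g * k) := by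
  classical
  refine LinearMap.congr_fun (f := LinearMap.proj g ∘ₗ peterWeyl n ∘ₗ
      Representation.sumExt (fun lam => specht lam) (fun lam => specht lam) (h, k))
    (g := LinearMap.proj (h⁻¹ * g * k) ∘ₗ peterWeyl n)
    (Representation.sumExt_hom_ext fun lam u v => ?_) q
  simp only [LinearMap.comp_apply, LinearMap.proj_apply]
  rw [Representation.sumExt_lof, peterWeyl_lof, peterWeyl_lof, matCoeff_equivariant]

/-- A nonzero element of `S^lam ⊗ S^lam` that is invariant under the diagonal action. -/
def casimir (lam : Ptn n) : (spechtSub lam).toSubmodule ⊗[ℂ] (spechtSub lam).toSubmodule :=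
  ∑ h : Equiv.Perm (Fin n), specht lam h (spechtPolytabloid (refTableau lam)) ⊗ₜ
    specht lam h (spechtPolytabloid (refTableau lam))

theorem matCoeff_casimir_conj (lam : Ptn n) (k g : Equiv.Perm (Fin n)) :
    matCoeff lam (casimir lam) (k * g * k⁻¹) = matCoeff lam (casimir lam) g := by
  rw [casimir, map_sum, Finset.sum_apply, Finset.sum_apply]
  refine Fintype.sum_equiv (Equiv.mulLeft k⁻¹) _ _ fun h => ?_
  have : h⁻¹ * (k * g * k⁻¹) * h = (k⁻¹ * h)⁻¹ * g * (k⁻¹ * h) := by group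
  rw [matCoeff_equivariant, Equiv.coe_mulLeft, matCoeff_equivariant, this]

theorem matCoeff_casimir_ne_zero (lam : Ptn n) : matCoeff lam (casimir lam) 1 ≠ 0 := by
  rw [casimir, map_sum, Finset.sum_apply]
  simp only [matCoeff_equivariant, mul_one, inv_mul_cancel]
  rw [Finset.sum_const, matCoeff_tmul, map_one, Module.End.one_apply]
  exact smul_ne_zero (by simp [Fintype.card_ne_zero]) (dot_polytabloid_self_ne_zero _)

/-- The matrix coefficient of `casimir lam`, as a function on the conjugacy classes. -/
def classCoeff (lam : Ptn n) : ConjClasses (Equiv.Perm (Fin n)) → ℂ :=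
  Quotient.lift (matCoeff lam (casimir lam)) fun σ τ h => by
    obtain ⟨k, rfl⟩ := isConj_iff.1 (show IsConj σ τ from h)
    exact (matCoeff_casimir_conj lam k σ).symm

/-- A relation is the Peter–Weyl image of $\sum c_\mu\,\mathrm{casimir}_\mu$. Injectivity separates
the summands, and no Casimir element is zero. -/
theorem linearIndependent_classCoeff :
    LinearIndependent ℂ (classCoeff : Ptn n → ConjClasses (Equiv.Perm (Fin n)) → ℂ) := by
  classical
  rw [Fintype.linearIndependent_iff]
  intro c hc lam
  have h₁ : peterWeyl n (∑ μ, c μ • DirectSum.lof ℂ (Ptn n)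
      (fun μ => (spechtSub μ).toSubmodule ⊗[ℂ] (spechtSub μ).toSubmodule) μ (casimir μ)) = 0 := by
    rw [map_sum]
    simp only [map_smul, peterWeyl_lof]
    funext g
    have := congrFun hc (ConjClasses.mk g)
    simp only [Finset.sum_apply, Pi.smul_apply] at this ⊢
    exact this
  have h₂ := congrArg (fun x => DirectSum.component ℂ (Ptn n)
      (fun μ => (spechtSub μ).toSubmodule ⊗[ℂ] (spechtSub μ).toSubmodule) lam x)
    (peterWeyl_injective n (h₁.trans (map_zero _).symm))
  simp only [map_sum, map_smul, map_zero] at h₂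
  rw [Finset.sum_eq_single lam, DirectSum.component.lof_self] at h₂
  · refine (smul_eq_zero.1 h₂).resolve_right fun h₃ => matCoeff_casimir_ne_zero lam ?_
    rw [h₃, map_zero, Pi.zero_apply]
  · intro μ _ hμ
    rw [DirectSum.component.of, dif_neg hμ, smul_zero]
  · simp

theorem peterWeyl_surjective (n : ℕ) : Function.Surjective (peterWeyl n) := by
  classical
  let _ : Fintype (ConjClasses (Equiv.Perm (Fin n))) := Fintype.ofFinite _
  -- Independent class functions, at least as many as there are classes, form a basis.
  have hspan : Submodule.span ℂ (Set.range (classCoeff (n := n))) = ⊤ := by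
    refine linearIndependent_classCoeff.span_eq_top_of_card_eq_finrank' (le_antisymm ?_ ?_)
    · exact linearIndependent_classCoeff.fintype_card_le_finrank
    · rw [Module.finrank_fintype_fun_eq_card]
      exact card_conjClasses_le
  have hrange : ∀ f : ConjClasses (Equiv.Perm (Fin n)) → ℂ,
      (fun g => f (ConjClasses.mk g)) ∈ LinearMap.range (peterWeyl n) := by
    intro f
    have hf : f ∈ Submodule.span ℂ (Set.range (classCoeff (n := n))) := hspan ▸ Submodule.mem_top
    refine Submodule.span_le (p := (LinearMap.range (peterWeyl n)).comap
      (LinearMap.funLeft ℂ ℂ ConjClasses.mk)).2 ?_ hf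
    rintro _ ⟨lam, rfl⟩
    exact ⟨_, peterWeyl_lof lam (casimir lam)⟩
  -- The identity is a conjugacy class by itself, so $\delta_1$ is a class function; its left
  -- translates are the other $\delta_k$.
  have hsingle : ∀ k, (Pi.single k 1 : Equiv.Perm (Fin n) → ℂ) ∈ LinearMap.range (peterWeyl n) := by
    intro k
    obtain ⟨q, hq⟩ := hrange (Pi.single (ConjClasses.mk 1) 1)
    refine ⟨Representation.sumExt (fun lam => specht lam) (fun lam => specht lam) (k, 1) q, ?_⟩
    funext g
    rw [peterWeyl_equivariant, hq, mul_one]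
    simp only [Pi.single_apply, ConjClasses.mk_eq_mk_iff_isConj, isConj_one_left, inv_mul_eq_one]
    simp only [eq_comm]
  intro f
  have hf : f = ∑ k, f k • (Pi.single k 1 : Equiv.Perm (Fin n) → ℂ) := by
    funext g
    simp [Finset.sum_apply, Pi.single_apply]
  change f ∈ LinearMap.range (peterWeyl n)
  rw [hf]
  exact Submodule.sum_mem _ fun k _ => Submodule.smul_mem _ _ (hsingle k)

/-- The sum of the `S^{lam'} ⊗ S^lam` is isomorphic to the functions on the symmetric group, with
the sign twisted action of the first factor. -/
theorem exists_signed_peterWeyl (n : ℕ) :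
    ∃ Φ : (⨁ lam : Ptn n, (spechtSub lam.conj).toSubmodule ⊗[ℂ] (spechtSub lam).toSubmodule) ≃ₗ[ℂ]
      (Equiv.Perm (Fin n) → ℂ), ∀ h k q g,
        Φ (Representation.sumExt (fun lam => specht lam.conj) (fun lam => specht lam) (h, k) q) g =
          sgn h * Φ q (h⁻¹ * g * k) := by
  classical
  choose θ hθ using exists_signTwist (n := n)
  let Θ : (⨁ lam : Ptn n, (spechtSub lam.conj).toSubmodule ⊗[ℂ] (spechtSub lam).toSubmodule) ≃ₗ[ℂ]
      (⨁ lam : Ptn n, (spechtSub lam).toSubmodule ⊗[ℂ] (spechtSub lam).toSubmodule) :=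
    DFinsupp.mapRange.linearEquiv fun lam =>
      TensorProduct.congr (θ lam) (LinearEquiv.refl ℂ (spechtSub lam).toSubmodule)
  have hΘlof (lam : Ptn n) (u : (spechtSub lam.conj).toSubmodule)
      (v : (spechtSub lam).toSubmodule) :
      Θ (DirectSum.lof ℂ (Ptn n) (fun lam =>
        (spechtSub lam.conj).toSubmodule ⊗[ℂ] (spechtSub lam).toSubmodule) lam (u ⊗ₜ v)) =
      DirectSum.lof ℂ (Ptn n) (fun lam =>
        (spechtSub lam).toSubmodule ⊗[ℂ] (spechtSub lam).toSubmodule) lam (θ lam u ⊗ₜ v) :=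
    DFinsupp.mapRange_single (hf := fun _ => map_zero _)
  refine ⟨Θ.trans (LinearEquiv.ofBijective (peterWeyl n)
    ⟨peterWeyl_injective n, peterWeyl_surjective n⟩), fun h k q g => ?_⟩
  have hΘ : Θ (Representation.sumExt (fun lam => specht lam.conj) (fun lam => specht lam) (h, k) q) =
      sgn h • Representation.sumExt (fun lam => specht lam) (fun lam => specht lam) (h, k) (Θ q) := by
    refine LinearMap.congr_fun (f := Θ.toLinearMap ∘ₗ
        Representation.sumExt (fun lam => specht lam.conj) (fun lam => specht lam) (h, k))
      (g := sgn h • Representation.sumExt (fun lam => specht lam) (fun lam => specht lam) (h, k) ∘ₗ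
        Θ.toLinearMap)
      (Representation.sumExt_hom_ext fun lam u v => ?_) q
    simp only [LinearMap.comp_apply, LinearMap.smul_apply, LinearEquiv.coe_coe]
    rw [Representation.sumExt_lof, hΘlof, hΘlof, Representation.sumExt_lof, ← map_smul,
      TensorProduct.smul_tmul', hθ]
  rw [LinearEquiv.trans_apply, LinearEquiv.trans_apply, hΘ, map_smul, Pi.smul_apply, smul_eq_mul]
  congr 1
  exact peterWeyl_equivariant h k (Θ q) g

end GenFoulkes

namespace GenFoulkes

/-! ### The Specht module of a column -/

theorem col_column {b : ℕ} (t : Tableau (column b)) (x : Fin b) : t.col x = 0 := by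
  have h := (t x).2
  simp only [column, Finset.mem_map] at h
  obtain ⟨i, -, hi⟩ := h
  exact (congrArg Prod.snd hi).symm

theorem polytabloid_column_act {b : ℕ} (t : Tableau (column b)) (σ : Equiv.Perm (Fin b)) :
    polytabloid (t.act σ) = sgn σ • polytabloid t :=
  polytabloid_act t fun x => by rw [col_column, col_column]

theorem specht_column {b : ℕ} (σ : Equiv.Perm (Fin b))
    (v : (spechtSub (column b)).toSubmodule) : specht (column b) σ v = sgn σ • v := by
  refine Subtype.ext ?_
  change tabloidModule (column b) σ v.1 = sgn σ • v.1
  refine Submodule.span_induction ?_ (by simp) (fun v w _ _ h h' => ?_) (fun c v _ h => ?_) v.2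
  · rintro _ ⟨t, rfl⟩
    dsimp only
    rw [tabloidModule_polytabloid, polytabloid_column_act]
  · rw [map_add, h, h', smul_add]
  · rw [map_smul, h, smul_comm]

theorem rowLens_column (b : ℕ) : (column b).1.rowLens = List.replicate b 1 := by
  have hmem (i j : ℕ) : (i, j) ∈ (column b).1 ↔ i < b ∧ j = 0 := by
    rw [← YoungDiagram.mem_cells]
    simp only [column, Finset.mem_map, Finset.mem_range]
    constructor
    · rintro ⟨k, hk, hkij⟩
      obtain ⟨rfl, rfl⟩ := Prod.mk.inj (show (k, 0) = (i, j) from hkij)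
      exact ⟨hk, rfl⟩
    · rintro ⟨hi, rfl⟩
      exact ⟨i, hi, rfl⟩
  have hcol : (column b).1.colLen 0 = b := by
    refine eq_of_forall_lt_iff fun i => ?_
    rw [← YoungDiagram.mem_iff_lt_colLen, hmem]
    simp
  have hrow (i : ℕ) (hi : i < b) : (column b).1.rowLen i = 1 := by
    refine eq_of_forall_lt_iff fun j => ?_
    rw [← YoungDiagram.mem_iff_lt_rowLen, hmem, Nat.lt_one_iff]
    simp [hi]
  refine List.eq_replicate_iff.2 ⟨by rw [YoungDiagram.length_rowLens, hcol], fun x hx => ?_⟩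
  rw [YoungDiagram.rowLens, List.mem_map, hcol] at hx
  obtain ⟨i, hi, rfl⟩ := hx
  exact hrow i (List.mem_range.1 hi)

theorem inP_column_iff {a b : ℕ} (g : Equiv.Perm (Fin (a * b))) :
    InP (column b) a b g ↔ ∀ i, interCard b a b g i = 1 := by
  rw [InP, rowLens_column, Multiset.coe_replicate]
  constructor
  · intro h i
    -- There are only $b$ parts, and $b$ nonzero sizes remain, so the filter removes nothing.
    have h₁ := Multiset.eq_of_le_of_card_le
      (Multiset.filter_le (fun m => m ≠ 0) ((Finset.univ : Finset (Fin b)).val.map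
        (interCard b a b g))) (by rw [h]; simp)
    rw [h₁] at h
    exact Multiset.eq_of_mem_replicate
      (h ▸ Multiset.mem_map_of_mem (interCard b a b g) (Finset.mem_univ i))
  · intro h
    rw [Multiset.map_congr rfl fun i _ => h i, Multiset.map_const', Multiset.filter_eq_self.2]
    · simp
    · intro x hx
      rw [Multiset.eq_of_mem_replicate hx]
      exact one_ne_zero

/-! ### Blocks -/

section Blocks

variable {a b c : ℕ} (h : b + c * b = a * b)

/-- The points `1, …, ab` as the disjoint union of the first `b` points and the others. -/
def splitPoints : Fin b ⊕ Fin (c * b) ≃ Fin (a * b) := finSumFinEquiv.trans (finCongr h)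

theorem young_splitPoints_inl (k : Equiv.Perm (Fin b) × Equiv.Perm (Fin (c * b))) (i : Fin b) :
    young h k (splitPoints h (Sum.inl i)) = splitPoints h (Sum.inl (k.1 i)) := by
  simp [young, splitPoints]

theorem young_splitPoints_inr (k : Equiv.Perm (Fin b) × Equiv.Perm (Fin (c * b)))
    (x : Fin (c * b)) :
    young h k (splitPoints h (Sum.inr x)) = splitPoints h (Sum.inr (k.2 x)) := by
  simp [young, splitPoints]

theorem block_splitPoints_inl (i : Fin b) : block a b (splitPoints h (Sum.inl i)) = i := by
  refine Fin.ext ?_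
  change (i : ℕ) % b = i
  exact Nat.mod_eq_of_lt i.2

theorem block_splitPoints_inr (x : Fin (c * b)) :
    block a b (splitPoints h (Sum.inr x)) = block c b x := by
  refine Fin.ext ?_
  change (b + (x : ℕ)) % b = x % b
  exact Nat.add_mod_left b x

theorem card_block_inl (i : Fin b) :
    (Finset.univ.filter fun z => block a b (splitPoints h (Sum.inl z)) = i).card = 1 :=
  Finset.card_eq_one.2 ⟨i, Finset.ext fun z => by
    rw [Finset.mem_filter, block_splitPoints_inl, Finset.mem_singleton,
      and_iff_right (Finset.mem_univ z)]⟩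

theorem forall_splitPoints {p : Fin (a * b) → Prop} :
    (∀ x, p x) ↔ (∀ i, p (splitPoints h (Sum.inl i))) ∧ ∀ x, p (splitPoints h (Sum.inr x)) := by
  rw [← (splitPoints h).forall_congr_right, Sum.forall]

/-- Each of the first $b$ points represents its own block, and the remaining points carry the
reference partition into blocks of size $c$. Hence the first component of `k` must be the block
permutation. -/
theorem young_mem_wreath_iff (k : Equiv.Perm (Fin b) × Equiv.Perm (Fin (c * b)))
    (σ : Equiv.Perm (Fin b)) :
    (young h k, σ) ∈ wreath a b ↔ k.1 = σ ∧ (k.2, σ) ∈ wreath c b := by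
  change (∀ x, block a b (young h k x) = σ (block a b x)) ↔
    _ ∧ ∀ x, block c b (k.2 x) = σ (block c b x)
  rw [forall_splitPoints h]
  simp only [young_splitPoints_inl, young_splitPoints_inr, block_splitPoints_inl,
    block_splitPoints_inr, Equiv.ext_iff]

theorem card_splitPoints (p : Fin (a * b) → Prop) [DecidablePred p] :
    (Finset.univ.filter p).card =
      (Finset.univ.filter fun i => p (splitPoints h (Sum.inl i))).card +
        (Finset.univ.filter fun x => p (splitPoints h (Sum.inr x))).card := by
  simp only [Finset.card_filter]
  rw [← Fintype.sum_equiv (splitPoints h) (fun z => if p (splitPoints h z) then 1 else 0) _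
    fun _ => rfl, Fintype.sum_sum_type]

theorem exists_perm_of_card_fiber {α β : Type*} [Fintype α] [DecidableEq β] (f f' : α → β)
    (hf : ∀ y, (Finset.univ.filter fun x => f x = y).card =
      (Finset.univ.filter fun x => f' x = y).card) :
    ∃ σ : Equiv.Perm α, ∀ x, f (σ x) = f' x := by
  have e (y : β) : Nonempty ({x // f' x = y} ≃ {x // f x = y}) := by
    rw [← Fintype.card_eq, Fintype.card_subtype, Fintype.card_subtype, hf]
  exact ⟨Equiv.ofFiberEquiv fun y => (e y).some, Equiv.ofFiberEquiv_map _⟩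

theorem interCard_eq (g : Equiv.Perm (Fin (a * b))) (i : Fin b) :
    interCard b a b g i =
      (Finset.univ.filter fun z => block a b (g⁻¹ (splitPoints h (Sum.inl z))) = i).card := by
  symm
  refine Finset.card_bij (fun z _ => g⁻¹ (splitPoints h (Sum.inl z))) ?_ ?_ ?_
  · intro z hz
    refine Finset.mem_filter.2 ⟨Finset.mem_univ _, (Finset.mem_filter.1 hz).2, ?_⟩
    rw [show g (g⁻¹ _) = _ from g.apply_symm_apply _]
    exact z.2
  · intro z _ z' _ hzz
    exact Sum.inl_injective ((splitPoints h).injective (g⁻¹.injective hzz))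
  · intro x hx
    obtain ⟨-, hxi, hxb⟩ := Finset.mem_filter.1 hx
    have hgx : splitPoints h (Sum.inl ⟨(g x : ℕ), hxb⟩) = g x := Fin.ext rfl
    have hgx' : g⁻¹ (splitPoints h (Sum.inl ⟨(g x : ℕ), hxb⟩)) = x := by
      rw [hgx]
      exact g.symm_apply_apply x
    exact ⟨⟨(g x : ℕ), hxb⟩, Finset.mem_filter.2 ⟨Finset.mem_univ _, by rw [hgx', hxi]⟩, hgx'⟩

theorem inP_column_one (h : b + c * b = a * b) : InP (column b) a b 1 := by
  refine (inP_column_iff 1).2 fun i => ?_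
  rw [interCard_eq h]
  exact card_block_inl h i

/-- An ordered set partition whose parts contain exactly one of the first `b` points is in the orbit
of the reference partition. -/
theorem exists_young_of_inP {g : Equiv.Perm (Fin (a * b))} (hg : InP (column b) a b g) :
    ∃ k, ((young h k)⁻¹ * g, (1 : Equiv.Perm (Fin b))) ∈ wreath a b := by
  rw [inP_column_iff] at hg
  have h₁ (i : Fin b) :
      (Finset.univ.filter fun z => block a b (g⁻¹ (splitPoints h (Sum.inl z))) = i).card =
        (Finset.univ.filter fun z => block a b (splitPoints h (Sum.inl z)) = i).card := by
    rw [← interCard_eq, hg, card_block_inl]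
  -- All parts have equal total size in both partitions, so equal counts among the first $b$ points
  -- force equal counts among the others.
  have h₂ (i : Fin b) :
      (Finset.univ.filter fun z => block a b (g⁻¹ (splitPoints h (Sum.inr z))) = i).card =
        (Finset.univ.filter fun z => block a b (splitPoints h (Sum.inr z)) = i).card := by
    have h₃ : (Finset.univ.filter fun x => block a b (g⁻¹ x) = i).card =
        (Finset.univ.filter fun x => block a b x = i).card :=
      Finset.card_equiv g⁻¹ fun x => by simp
    rw [card_splitPoints h, card_splitPoints h, h₁] at h₃
    exact Nat.add_left_cancel h₃
  obtain ⟨k₁, hk₁⟩ := exists_perm_of_card_fiber _ _ h₁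
  obtain ⟨k₂, hk₂⟩ := exists_perm_of_card_fiber _ _ h₂
  refine ⟨(k₁, k₂), ?_⟩
  have h₃ : (g⁻¹ * young h (k₁, k₂), (1 : Equiv.Perm (Fin b))) ∈ wreath a b := by
    change ∀ x, block a b (g⁻¹ (young h (k₁, k₂) x)) = block a b x
    rw [forall_splitPoints h]
    simp only [young_splitPoints_inl, young_splitPoints_inr]
    exact ⟨hk₁, hk₂⟩
  have h₄ := (wreath a b).inv_mem h₃
  rwa [Prod.inv_mk, mul_inv_rev, inv_inv, inv_one] at h₄

end Blocks

/-! ### The component as an induced module -/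

theorem foulkes_wreath {a b : ℕ} {ν : Ptn b} {g : Equiv.Perm (Fin (a * b))}
    {σ : Equiv.Perm (Fin b)} (hg : (g, σ) ∈ wreath a b) (v : (spechtSub ν).toSubmodule) :
    foulkes a ν g (Representation.IndV.mk (wreathToPoints a b) (inflation a ν) 1 v) =
      Representation.IndV.mk (wreathToPoints a b) (inflation a ν) 1 (specht ν σ v) :=
  (Representation.mk_one_act (wreathToPoints a b) (inflation a ν) ⟨(g, σ), hg⟩ v).symm

theorem foulkesPolytabloid_eq {a b : ℕ} {ν : Ptn b} (g : Equiv.Perm (Fin (a * b)))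
    (t : Tableau ν) : foulkesPolytabloid a g t = foulkes a ν g (foulkesPolytabloid a 1 t) := by
  rw [foulkesPolytabloid, foulkesPolytabloid, map_one, Module.End.one_apply]

theorem foulkesPolytabloid_one {a b : ℕ} {ν : Ptn b} (t : Tableau ν) :
    foulkesPolytabloid a 1 t = Representation.IndV.mk (wreathToPoints a b) (inflation a ν) 1
      (spechtPolytabloid t) := by
  rw [foulkesPolytabloid, map_one, Module.End.one_apply]

/-- Transitivity of $S_b\times S_{cb}$ on the relevant partitions moves $g$ to a permutation that
fixes every block; a change of tableau costs only a sign. -/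
theorem component_column {a b c : ℕ} (h : b + c * b = a * b) :
    (component a (column b) h (column b)).toSubmodule =
      Submodule.span ℂ (Set.range fun k => foulkesRes a (column b) h k
        (foulkesPolytabloid a 1 (refTableau (column b)))) := by
  refine le_antisymm (Submodule.span_le.2 ?_) (Submodule.span_le.2 ?_)
  · rintro _ ⟨g, t, hg, rfl⟩
    obtain ⟨k, hk⟩ := exists_young_of_inP h hg
    obtain ⟨σ, rfl⟩ := exists_act_eq (refTableau (column b)) t
    have h₁ : spechtPolytabloid ((refTableau (column b)).act σ) =
        sgn σ • spechtPolytabloid (refTableau (column b)) :=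
      Subtype.ext (polytabloid_column_act _ σ)
    have h₂ : foulkesPolytabloid a g ((refTableau (column b)).act σ) =
        sgn σ • foulkesRes a (column b) h k
          (foulkesPolytabloid a 1 (refTableau (column b))) := by
      rw [foulkesPolytabloid_eq, ← mul_inv_cancel_left (young h k) g, map_mul,
        Module.End.mul_apply, foulkesPolytabloid_one, foulkes_wreath hk, map_one,
        Module.End.one_apply, h₁, map_smul, map_smul, foulkesPolytabloid_one]
      rfl
    rw [h₂]
    exact Submodule.smul_mem _ _ (Submodule.subset_span ⟨k, rfl⟩)
  · rintro _ ⟨k, rfl⟩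
    refine Submodule.subset_span ⟨young h k, refTableau (column b), ?_, ?_⟩
    · rw [← mul_one (young h k), inP_young_mul]
      exact inP_column_one h
    · exact (foulkesPolytabloid_eq _ _).symm

theorem nonempty_equiv_U {a b c : ℕ} (h : b + c * b = a * b) :
    Nonempty ((U a (column b) h).Equiv
      (Representation.directSum fun lam : Ptn b =>
        extTensor (specht lam.conj) (foulkes c lam))) := by
  classical
  obtain ⟨Φ, hΦ⟩ := exists_signed_peterWeyl b
  let _ : Fintype (wreath a b) := Fintype.ofFinite _
  let _ : AddCommGroup (⨁ lam : Ptn b, (spechtSub lam.conj).toSubmodule ⊗[ℂ]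
      Representation.IndV (wreathToPoints c b) (inflation c lam)) :=
    Module.addCommMonoidToAddCommGroup ℂ
  -- A coordinate on the sign module, normalized to be 1 at the reference polytabloid.
  let c₀ : (spechtSub (column b)).toSubmodule →ₗ[ℂ] ℂ :=
    dot (column b) (MonoidAlgebra.single (Tabloid.mk (refTableau (column b))) 1) ∘ₗ
      (spechtSub (column b)).toSubmodule.subtype
  have hc₀ : c₀ (spechtPolytabloid (refTableau (column b))) = 1 :=
    (dot_single _ _ _).trans (coeff_polytabloid_self _)
  let χ : wreath a b →* ℂ := sgn.comp (wreathToBlocks a b)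
  have hχ (w v) : c₀ (inflation a (column b) w v) = χ w * c₀ v := by
    change c₀ (specht (column b) (wreathToBlocks a b w) v) = _
    rw [specht_column, map_smul]
    rfl
  let τ := Representation.sumInd (wreathToPoints c b) (wreathToBlocks c b)
    (fun lam : Ptn b => specht lam.conj) (fun lam => specht lam)
  let e := Representation.toSumInd (X := fun lam : Ptn b => (spechtSub lam.conj).toSubmodule)
    (wreathToPoints c b) (wreathToBlocks c b) (fun lam : Ptn b => specht lam)
    (Φ.symm (Pi.single 1 1))
  -- The candidate image `e` of the generator transforms under the diagonal wreath product as $E$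
  -- does, since $\delta_1$ is invariant under conjugation.
  have he (w : wreath c b) :
      τ (wreathToBlocks c b w, wreathToPoints c b w) e = sgn (wreathToBlocks c b w) • e := by
    refine (Representation.sumInd_toSumInd_diag _ _ _ _ w _).trans ?_
    rw [← map_smul]
    congr 1
    refine Φ.injective (funext fun g => ?_)
    rw [hΦ, map_smul, LinearEquiv.apply_symm_apply, Pi.smul_apply, smul_eq_mul]
    congr 1
    simp only [Pi.single_apply, mul_assoc, inv_mul_eq_one, right_eq_mul]
  -- An element of $S_b\times S_{cb}$ that comes from $S_a\wr S_b$ is diagonal from $S_c\wr S_b$, so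
  -- `he` gives the compatibility that the averaging map requires.
  have he' (k w) (hkw : young h k = wreathToPoints a b w) : τ k e = χ w • e := by
    have h₁ : (young h k, wreathToBlocks a b w) ∈ wreath a b := by
      rw [hkw]
      exact w.2
    obtain ⟨h₂, h₃⟩ := (young_mem_wreath_iff h k _).1 h₁
    have h₄ := he ⟨_, h₃⟩
    change τ (wreathToBlocks a b w, k.2) e = χ w • e at h₄
    rwa [← h₂] at h₄
  obtain ⟨N, hN, hβ⟩ := Representation.mackeyMap_mk_one (wreathToPoints a b)
    (inflation a (column b)) (young h) τ χ c₀ hχ e he'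
  refine Representation.nonempty_equiv_sumInd (wreathToPoints c b) (wreathToBlocks c b)
    (fun lam : Ptn b => specht lam.conj) (fun lam => specht lam) sgn (foulkesRes a (column b) h)
    (foulkesPolytabloid a 1 (refTableau (column b))) Φ hΦ sgn_mul_self (fun w => ?_)
    (Representation.mackeyMap (wreathToPoints a b) (inflation a (column b)) (young h) τ χ c₀ hχ e)
    (fun k v => Representation.mackeyMap_equivariant _ _ _ _ _ _ _ _ k v) N hN ?_
    (component a (column b) h (column b)) (component_column h)
  · rw [foulkesPolytabloid_one, ← map_smul, ← specht_column]
    exact foulkes_wreath ((young_mem_wreath_iff h _ _).2 ⟨rfl, w.2⟩) _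
  · rw [foulkesPolytabloid_one, hβ, hc₀, mul_one]

/-! ### The case of blocks of size one -/

theorem block_one {b : ℕ} (x : Fin (1 * b)) : block 1 b x = (finCongr (one_mul b).symm).symm x := by
  refine Fin.ext ?_
  exact Nat.mod_eq_of_lt (x.2.trans_eq (one_mul b))

/-- With blocks of size one, points and blocks coincide, so $S_1\wr S_b$ is the graph of an
isomorphism and inducing along it changes nothing. -/
theorem mem_wreath_one_iff {b : ℕ} (g : Equiv.Perm (Fin (1 * b))) (σ : Equiv.Perm (Fin b)) :
    (g, σ) ∈ wreath 1 b ↔ Equiv.permCongrHom (finCongr (one_mul b).symm) σ = g := by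
  change (∀ x, block 1 b (g x) = σ (block 1 b x)) ↔ _
  rw [Equiv.ext_iff]
  refine forall_congr' fun x => ?_
  rw [block_one, block_one, Equiv.symm_apply_eq, eq_comm]
  rfl

/-- `F_λ^1` is the Specht module `S^λ`. -/
theorem nonempty_equiv_foulkes_one {b : ℕ} (lam : Ptn b) :
    Nonempty (Representation.Equiv ((foulkes 1 lam).comp
      (Equiv.permCongrHom (finCongr (one_mul b).symm)).toMonoidHom) (specht lam)) := by
  set r := Equiv.permCongrHom (finCongr (one_mul b).symm) with hr
  have hw (w : wreath 1 b) : r.symm (wreathToPoints 1 b w) = wreathToBlocks 1 b w := by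
    rw [MulEquiv.symm_apply_eq]
    exact ((mem_wreath_one_iff _ _).1 w.2).symm
  let f : Representation.IndV (wreathToPoints 1 b) (inflation 1 lam) →ₗ[ℂ]
      (spechtSub lam).toSubmodule :=
    Representation.liftIndV _ _ (fun y => specht lam (r.symm y⁻¹)) fun w y v => by
      change specht lam _ (specht lam (wreathToBlocks 1 b w) v) = _
      rw [← hw, ← Module.End.mul_apply, ← map_mul, ← map_mul, mul_inv_rev, inv_mul_cancel_right]
  have hf (y v) : f (Representation.IndV.mk _ _ y v) = specht lam (r.symm y⁻¹) v :=
    Representation.liftIndV_mk _ _ _ _ y v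
  have hmk (σ : Equiv.Perm (Fin b)) (v) :
      foulkes 1 lam (r σ) (Representation.IndV.mk (wreathToPoints 1 b) (inflation 1 lam) 1 v) =
        Representation.IndV.mk (wreathToPoints 1 b) (inflation 1 lam) 1 (specht lam σ v) :=
    foulkes_wreath ((mem_wreath_one_iff _ _).2 rfl) v
  refine ⟨Representation.Equiv.mk (LinearEquiv.ofLinearMap f
    (Representation.IndV.mk (wreathToPoints 1 b) (inflation 1 lam) 1) ?_ ?_) fun σ => ?_⟩
  · refine LinearMap.ext fun v => (hf 1 v).trans ?_
    rw [inv_one, map_one, map_one]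
    rfl
  · refine Representation.indV_hom_ext _ _ fun y v => ?_
    refine (congrArg (Representation.IndV.mk (wreathToPoints 1 b) (inflation 1 lam) 1)
      (hf y v)).trans ?_
    rw [← hmk, MulEquiv.apply_symm_apply, ← Representation.mk_eq_ind]
    rfl
  · refine Representation.indV_hom_ext _ _ fun y v => ?_
    change f (foulkes 1 lam (r σ) (Representation.IndV.mk _ _ y v)) =
      specht lam σ (f (Representation.IndV.mk _ _ y v))
    rw [Representation.ind_mk', hf, hf, mul_inv_rev, inv_inv, map_mul, MulEquiv.symm_apply_apply,
      map_mul, Module.End.mul_apply]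

theorem nonempty_equiv_directSum_extTensor {G H ι : Type*} [Group G] [Group H] {X Y Z : ι → Type*}
    [∀ i, AddCommGroup (X i)] [∀ i, Module ℂ (X i)] [∀ i, AddCommGroup (Y i)]
    [∀ i, Module ℂ (Y i)] [∀ i, AddCommGroup (Z i)] [∀ i, Module ℂ (Z i)]
    (ξ : ∀ i, Representation ℂ G (X i)) {η : ∀ i, Representation ℂ H (Y i)}
    {ζ : ∀ i, Representation ℂ H (Z i)} (e : ∀ i, (η i).Equiv (ζ i)) :
    Nonempty ((Representation.directSum fun i => extTensor (ξ i) (η i)).Equiv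
      (Representation.directSum fun i => extTensor (ξ i) (ζ i))) := by
  classical
  refine ⟨Representation.Equiv.mk (DFinsupp.mapRange.linearEquiv fun i =>
    TensorProduct.congr (LinearEquiv.refl ℂ (X i)) (e i).toLinearEquiv) fun g => ?_⟩
  refine LinearMap.ext fun x => DFinsupp.ext fun i => ?_
  refine LinearMap.congr_fun (f := (TensorProduct.congr (LinearEquiv.refl ℂ (X i))
      (e i).toLinearEquiv).toLinearMap ∘ₗ TensorProduct.map (ξ i g.1) (η i g.2))
    (g := TensorProduct.map (ξ i g.1) (ζ i g.2) ∘ₗ (TensorProduct.congr (LinearEquiv.refl ℂ (X i))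
      (e i).toLinearEquiv).toLinearMap) (TensorProduct.ext' fun u v => ?_) (x i)
  change _ ⊗ₜ _ = _ ⊗ₜ _
  congr 1
  exact LinearMap.congr_fun ((e i).isIntertwining' g.2) v

theorem nonempty_equiv_U_of_eq {a b c l : ℕ} (h : b + l = a * b) (hl : l = c * b) :
    Nonempty ((U a (column b) h).Equiv
      (Representation.directSum fun lam : Ptn b => extTensor (specht lam.conj)
        ((foulkes c lam).comp (Equiv.permCongrHom (finCongr hl)).toMonoidHom))) := by
  subst hl
  exact nonempty_equiv_U h

end GenFoulkes

end

theorem corollary2 (b : ℕ) :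
    (∀ (a : ℕ) (ha : 1 ≤ a),
      Nonempty ((U a (column b) (add_pred_mul b ha)).Equiv
        (Representation.directSum fun lam : Ptn b =>
          extTensor (specht lam.conj) (foulkes (a - 1) lam)))) ∧
    Nonempty ((U 2 (column b) (two_mul b).symm).Equiv
      (Representation.directSum fun lam : Ptn b =>
        extTensor (specht lam.conj) (specht lam))) := by
  refine ⟨fun a ha => nonempty_equiv_U (add_pred_mul b ha), ?_⟩
  obtain ⟨e₁⟩ := nonempty_equiv_U_of_eq (c := 1) (two_mul b).symm (one_mul b).symm
  obtain ⟨e₂⟩ := nonempty_equiv_directSum_extTensor (fun lam : Ptn b => specht lam.conj)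
    fun lam : Ptn b => (nonempty_equiv_foulkes_one lam).some
  exact ⟨e₁.trans e₂⟩
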